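/- Let $\mathcal U,\mathcal V,\mathcal X,\mathcal Y,\mathcal S,\mathcal Z$ be finite sets and let $R>0$. All logarithms are to base 2. **Source and channel.** A finite-state source with initial state $s_1\in\mathcal S$ emits $(\boldsymbol u,\boldsymbol v)\in\mathcal U^n\times\mathcal V^n$ with probability $P(\boldsymbol u,\boldsymbol v)=\prod_{t=1}^nP(u_t,v_t|s_t)$, $s_t=g(s_{t-1},u_{t-1},v_{t-1})$. A finite-state channel with initial state $z_1\in\mathcal Z$ has transition law $W(\boldsymbol y|\boldsymbol x)=\prod_{t=1}^nW(y_t|x_t,z_t)$, $z_t=h(z_{t-1},x_{t-1},y_{t-1})$. Assume that the side information never resolves the source: there is an $L$ such that for all $n\ge L$ and all $(\boldsymbol u,\boldsymbol v)$ of length $n$ with $P(\boldsymbol u,\boldsymbol v)>0$ there is $\boldsymbol u'\ne\boldsymbol u$ with $u'_t=u_t$ for all $t\le n-L$ and $P(\boldsymbol u',\boldsymbol v)>0$ (for instance, $|\mathcal U|\ge2$ and all $P(u,v|s)>0$). **Coding.** For each $n$, every $\boldsymbol u\in\mathcal U^n$ is assigned independently and uniformly at random to one of $M=\lceil2^{nR}\rceil$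 bins, $f(\boldsymbol u)\in\{1,\dots,M\}$, and codewords $\boldsymbol x(1),\dots,\boldsymbol x(M)\in\mathcal X^n$ are drawn independently from a probability distribution $Q=Q_n$ on $\mathcal X^n$, all independently of the source. Write $\boldsymbol x[\boldsymbol u]=\boldsymbol x(f(\boldsymbol u))$. When the source emits $(\boldsymbol u,\boldsymbol v)$, $\boldsymbol x[\boldsymbol u]$ is sent over the channel; the decoder knows $f$, the codebook, $\boldsymbol v$ and the channel output $\boldsymbol y$. Assume that either every $Q_n$ is exchangeable (invariant under permutations of the coordinates), or, more generally, the channel state has a component $\sigma_t$ that evolves as a function of $(\sigma_{t-1},x_{t-1})$ only, and every $Q_n(\boldsymbol x)$ depends only on the joint type of $(\boldsymbol x,\boldsymbol\sigma)$, where $\boldsymbol\sigma=(\sigma_1,\dots,\sigma_n)$ is the sequence induced by $\boldsymbol x$. **Decoders.** For sequences $\boldsymbol a,\boldsymbol b$ of length $n$, parse $((a_1,b_1),\dots,(a_n,b_n))$ incrementally (Lempel–Ziv 1978) into phrases, let $b(1),\dots,b(c)$ be the distinct $b$-phrases that occur, let $c_\ell(\boldsymbol a|\boldsymbol b)$ be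 the number of distinct $a$-phrases that appear jointly with $b(\ell)$, and let $\hat H_{LZ}(\boldsymbol a|\boldsymbol b)=\frac1n\sum_{\ell=1}^{c}c_\ell(\boldsymbol a|\boldsymbol b)\log c_\ell(\boldsymbol a|\boldsymbol b)$, where a last phrase left incomplete by the parsing, which repeats an earlier phrase, is not counted. Put $\hat I_{LZ}(\boldsymbol x;\boldsymbol y)=-\frac1n\log Q(\boldsymbol x)-\hat H_{LZ}(\boldsymbol x|\boldsymbol y)$. The MAP decoder outputs a maximizer over $\boldsymbol u\in\mathcal U^n$ of $P(\boldsymbol u,\boldsymbol v)W(\boldsymbol y|\boldsymbol x[\boldsymbol u])$; the universal decoder outputs a maximizer over $\boldsymbol u\in\mathcal U^n$ of $\hat I_{LZ}(\boldsymbol x[\boldsymbol u];\boldsymbol y)-\hat H_{LZ}(\boldsymbol u|\boldsymbol v)$; ties are broken in any way. Let $P_e^{MAP}(n)$ and $P_e^{u}(n)$ be their probabilities of not reproducing the source vector, averaged over source, channel, binning and codebook. **Claim.** For all sufficiently large $n$ both error probabilities are positive, and $$\lim_{n\to\infty}\frac1n\log\frac{P_e^{u}(n)}{P_e^{MAP}(n)}=0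 .$$ -/

import Mathlib

open Filter Topology

/-! ### Finite-state sources and channels

Sequences of length `n` are functions on `Fin n`; time runs through `0, …, n - 1`. -/

/-- A nonnegative function on a finite set with total mass one. -/
def IsDistribution {A : Type*} [Fintype A] (q : A → ℝ) : Prop :=
  (∀ a, 0 ≤ q a) ∧ ∑ a, q a = 1

/-- A finite-state source of pairs: in state `s` the pair `(u, v)` is emitted with probability
`prob s (u, v)`, after which the state becomes `next s u v`. -/
structure FiniteStateSource (U V S : Type*) [Fintype U] [Fintype V] where
  next : S → U → V → S
  prob : S → U × V → ℝ
  isDistribution : ∀ s, IsDistribution (prob s)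

/-- A finite-state channel: in state `z`, input `x` produces output `y` with probability
`prob z x y`, after which the state becomes `next z x y`. -/
structure FiniteStateChannel (X Y Z : Type*) [Fintype Y] where
  next : Z → X → Y → Z
  prob : Z → X → Y → ℝ
  isDistribution : ∀ z x, IsDistribution (prob z x)

/-- The state before time `t` of an automaton that starts in `s` and is driven by the letters
`a 0, a 1, …`. -/
def driveState {A S : Type*} {n : ℕ} (step : S → A → S) (s : S) (a : Fin n → A) : ℕ → S
  | 0 => s
  | t + 1 =>
    if h : t < n then step (driveState step s a t) (a ⟨t, h⟩) else driveState step s a t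

section SourceAndChannel

variable {U V S X Y Z : Type*} [Fintype U] [Fintype V] [Fintype Y] {n : ℕ}

/-- `P(u, v) = ∏ₜ P(uₜ, vₜ | sₜ)`, with initial state `s`. -/
def FiniteStateSource.seqProb (src : FiniteStateSource U V S) (s : S)
    (u : Fin n → U) (v : Fin n → V) : ℝ :=
  ∏ t : Fin n,
    src.prob (driveState (fun s (a : U × V) => src.next s a.1 a.2) s (fun i => (u i, v i)) t)
      (u t, v t)

/-- `W(y | x) = ∏ₜ W(yₜ | xₜ, zₜ)`, with initial state `z`. -/
def FiniteStateChannel.seqProb (W : FiniteStateChannel X Y Z) (z : Z)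
    (x : Fin n → X) (y : Fin n → Y) : ℝ :=
  ∏ t : Fin n,
    W.prob (driveState (fun z (a : X × Y) => W.next z a.1 a.2) z (fun i => (x i, y i)) t)
      (x t) (y t)

/-- The side information never resolves the source: for some `L`, the last `L` source letters
are never determined with certainty by the earlier source letters and the whole side-information
sequence. A source all of whose letter probabilities `P(u, v | s)` are positive, over an alphabet
`U` with at least two letters, has this property with `L = 1`. -/
def FiniteStateSource.Ambiguous (src : FiniteStateSource U V S) (s : S) : Prop :=
  ∃ L : ℕ, ∀ n : ℕ, L ≤ n → ∀ (u : Fin n → U) (v : Fin n → V), 0 < src.seqProb s u v →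
    ∃ u' : Fin n → U, u' ≠ u ∧ (∀ t : Fin n, (t : ℕ) + L < n → u' t = u t) ∧
      0 < src.seqProb s u' v

/-- A component `σ = proj z` of the channel state, with values in `T`, that is driven by the
channel input alone. -/
structure InputDrivenComponent (W : FiniteStateChannel X Y Z) (T : Type*) where
  proj : Z → T
  next : T → X → T
  compat : ∀ z x y, proj (W.next z x y) = next (proj z) x

/-- The sequence `σ` induced by the input `x` when the channel starts in state `z`. -/
def InputDrivenComponent.seq {T : Type*} {W : FiniteStateChannel X Y Z}
    (c : InputDrivenComponent W T) (z : Z) (x : Fin n → X) (t : Fin n) : T :=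
  driveState c.next (c.proj z) x t

/-- Equal joint empirical distributions: `a'` is a rearrangement of `a`. -/
def SameType {A : Type*} (a a' : Fin n → A) : Prop :=
  ∃ π : Equiv.Perm (Fin n), a' = a ∘ π

/-- An exchangeable function on sequences. -/
def Exchangeable (q : (Fin n → X) → ℝ) : Prop :=
  ∀ x x' : Fin n → X, SameType x x' → q x' = q x

/-- Invariance within conditional types given `σ`: `q x` depends only on the joint type of
`(x, σ)`, where `σ` is the component sequence induced by `x`. -/
def InputDrivenComponent.Invariant {T : Type*} {W : FiniteStateChannel X Y Z}
    (c : InputDrivenComponent W T) (z : Z) (q : (Fin n → X) → ℝ) : Prop :=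
  ∀ x x' : Fin n → X,
    SameType (fun t => (x t, c.seq z x t)) (fun t => (x' t, c.seq z x' t)) → q x' = q x

end SourceAndChannel

/-! ### Conditional Lempel-Ziv compressibility -/

section LempelZiv

/-- Incremental parsing: `dict` holds the completed phrases, `cur` the phrase under construction.
A phrase is completed as soon as it differs from all completed phrases. A last phrase left
incomplete repeats an earlier phrase, so the result lists the distinct phrases, each once. -/
def lzParse {A : Type*} [DecidableEq A] (dict : List (List A)) (cur : List A) :
    List A → List (List A)
  | [] => dict
  | a :: l =>
    if cur ++ [a] ∈ dict then lzParse dict (cur ++ [a]) l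
    else lzParse (dict ++ [cur ++ [a]]) [] l

variable {X Y : Type*} [DecidableEq X] [DecidableEq Y] {n : ℕ}

/-- The distinct phrases in the joint incremental parsing of `((x₁, y₁), …, (xₙ, yₙ))`. -/
def jointPhrases (x : Fin n → X) (y : Fin n → Y) : List (List (X × Y)) :=
  lzParse [] [] (List.ofFn fun t => (x t, y t))

/-- The distinct `y`-phrases in the joint parsing. -/
def sidePhrases (x : Fin n → X) (y : Fin n → Y) : Finset (List Y) :=
  ((jointPhrases x y).map (List.map Prod.snd)).toFinset

/-- The number of distinct `x`-phrases that appear jointly with the `y`-phrase `w`. -/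
def phraseCount (x : Fin n → X) (y : Fin n → Y) (w : List Y) : ℕ :=
  ((jointPhrases x y).toFinset.filter (fun p => p.map Prod.snd = w)).card

/-- `Ĥ_LZ(x | y) = (1/n) ∑_ℓ c_ℓ(x|y) log₂ c_ℓ(x|y)`, the sum being over the distinct
`y`-phrases. -/
noncomputable def condLZ (x : Fin n → X) (y : Fin n → Y) : ℝ :=
  (∑ w ∈ sidePhrases x y, (phraseCount x y w : ℝ) * Real.logb 2 (phraseCount x y w)) / n

/-- `Î_LZ(x; y) = -(1/n) log₂ Q(x) - Ĥ_LZ(x | y)`. -/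
noncomputable def infoLZ (q : (Fin n → X) → ℝ) (x : Fin n → X) (y : Fin n → Y) : ℝ :=
  -(Real.logb 2 (q x)) / n - condLZ x y

end LempelZiv

/-! ### Random binning, random coding and decoding -/

section System

/-- The number of bins `2^{nR}`, rounded up to an integer. -/
noncomputable def numBins (R : ℝ) (n : ℕ) : ℕ := ⌈(2 : ℝ) ^ ((n : ℝ) * R)⌉₊

/-- A decoder sees the binning function `f`, the codebook `C`, the side information and the
channel output. -/
abbrev Decoder (U V X Y : Type*) (n M : ℕ) : Type _ :=
  ((Fin n → U) → Fin M) → (Fin M → Fin n → X) → (Fin n → V) → (Fin n → Y) → (Fin n → U)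

variable {U V S X Y Z : Type*} [Fintype U] [Fintype V] [Fintype X] [Fintype Y] {n M : ℕ}

/-- `d` outputs a maximizer of `P(u, v) W(y | x[u])`; ties are broken arbitrarily. -/
def IsMAPDecoder (src : FiniteStateSource U V S) (s : S) (W : FiniteStateChannel X Y Z) (z : Z)
    (d : Decoder U V X Y n M) : Prop :=
  ∀ f C v y u, src.seqProb s u v * W.seqProb z (C (f u)) y ≤
    src.seqProb s (d f C v y) v * W.seqProb z (C (f (d f C v y))) y

/-- `d` outputs a maximizer of `Î_LZ(x[u]; y) - Ĥ_LZ(u | v)`; ties are broken arbitrarily. -/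
def IsLZDecoder [DecidableEq U] [DecidableEq V] [DecidableEq X] [DecidableEq Y]
    (q : (Fin n → X) → ℝ) (d : Decoder U V X Y n M) : Prop :=
  ∀ f C v y u, infoLZ q (C (f u)) y - condLZ u v ≤
    infoLZ q (C (f (d f C v y))) y - condLZ (d f C v y) v

/-- The average error probability `Pr{d ≠ U}`: every source vector is assigned to one of the `M`
bins uniformly, the `M` codewords are drawn from `q`, all independently of each other and of the
source, and the codeword of the bin of the source vector is sent over the channel. -/
noncomputable def errorProb [DecidableEq U]
    (src : FiniteStateSource U V S) (s : S) (W : FiniteStateChannel X Y Z) (z : Z)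
    (q : (Fin n → X) → ℝ) (d : Decoder U V X Y n M) : ℝ :=
  ∑ f : (Fin n → U) → Fin M, ∑ C : Fin M → Fin n → X,
    ∑ u : Fin n → U, ∑ v : Fin n → V, ∑ y : Fin n → Y,
      (∏ _u : Fin n → U, (1 / (M : ℝ))) * (∏ j, q (C j)) *
        (src.seqProb s u v * W.seqProb z (C (f u)) y) * (if d f C v y ≠ u then 1 else 0)

end System

/-
The proof rests on two properties of the weight `2 ^ (n Ĥ_LZ(x | y))`, both up to a subexponential
factor. It satisfies a Kraft inequality: for every `y` the reciprocals of the weights sum to at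
most `e ^ (ε n)`, because few parsings share a list of `y`-phrases. And it is at most the size of
the conditional path class of `x` given `y`, the set of all `x'` for which `(x', y)` makes a given
automaton traverse the same transitions equally often: exchanging phrases that have the same
`y`-part and the same end states of the automaton leads from `x` to elements of this class.

The source probability is constant on the path classes of the source, and by the invariance of
`Q n` both the codeword probability and the channel transition probability are constant on the
path classes of the channel. Given the transmitted pair, a decoder with a decision metric errs
when one of the competing source vectors does as well. For the Lempel-Ziv metric, the union bound
and the Kraft inequality bound this probability from above; for the true likelihood, the
competitors include a full path class, and a second-moment estimate bounds it from below. Both are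
`min 1 (N * (1 / M + q))` up to a subexponential factor, where `N` is the number of competitors and
`q` the probability that a random codeword competes.
-/

/-! ### Incremental parsings -/

section Parsing

/-- The lists of phrases that incremental parsing can produce: every phrase is new and extends
the empty word or an earlier phrase by one letter. -/
inductive Incremental {A : Type*} : List (List A) → Prop
  | nil : Incremental []
  | snoc {D : List (List A)} {p : List A} {a : A} : Incremental D → p ∈ [] :: D →
      p ++ [a] ∉ D → Incremental (D ++ [p ++ [a]])

theorem Incremental.ne_nil {A : Type*} {D : List (List A)} (h : Incremental D) :
    ∀ p ∈ D, p ≠ [] := by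
  induction h with
  | nil => simp
  | snoc _ _ _ ih =>
    intro q hq
    rcases List.mem_append.1 hq with hq | hq
    · exact ih q hq
    · simp_all

theorem Incremental.nodup {A : Type*} {D : List (List A)} (h : Incremental D) : D.Nodup := by
  induction h with
  | nil => exact List.nodup_nil
  | snoc _ _ hn ih =>
    rw [List.nodup_append]
    refine ⟨ih, List.nodup_singleton _, ?_⟩
    rintro q hq r hr rfl
    exact hn (List.mem_singleton.1 hr ▸ hq)

theorem lzParse_spec {A : Type*} [DecidableEq A] (l : List A) :
    ∀ (dict : List (List A)) (cur : List A), Incremental dict → cur ∈ [] :: dict →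
      Incremental (lzParse dict cur l) ∧
      ∃ r ∈ [] :: lzParse dict cur l,
        (lzParse dict cur l).flatten ++ r = dict.flatten ++ cur ++ l := by
  induction l with
  | nil => exact fun dict cur hd hc => ⟨hd, cur, hc, by simp [lzParse]⟩
  | cons a l ih =>
    intro dict cur hd hc
    by_cases h : cur ++ [a] ∈ dict
    · simpa [lzParse, h] using ih dict (cur ++ [a]) hd (List.mem_cons_of_mem _ h)
    · simpa [lzParse, h] using ih (dict ++ [cur ++ [a]]) [] (hd.snoc hc h) List.mem_cons_self

theorem mul_length_le_add_length_flatten {A : Type*} (m : ℕ) (D : List (List A)) :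
    m * D.length ≤ m * D.countP (fun p => p.length < m) + D.flatten.length := by
  induction D with
  | nil => simp
  | cons p D ih =>
    rw [List.length_cons, List.countP_cons, List.flatten_cons, List.length_append]
    by_cases h : p.length < m
    · simp only [h, decide_true, if_true, mul_add]
      omega
    · simp only [h, decide_false, Bool.false_eq_true, if_false, mul_add]
      omega

/-- Families of distinct words of total length `n` have `o(n)` members. -/
theorem eventually_length_le (A : Type*) [Finite A] {δ : ℝ} (hδ : 0 < δ) :
    ∀ᶠ n : ℕ in atTop, ∀ D : List (List A), D.Nodup → D.flatten.length ≤ n →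
      (D.length : ℝ) ≤ δ * n := by
  classical
  obtain ⟨m, hm⟩ := exists_nat_gt (2 / δ)
  have hm0 : (0 : ℝ) < m := lt_trans (by positivity) hm
  set F := (List.finite_length_lt A m).toFinset with hF
  obtain ⟨N, hN⟩ := exists_nat_gt (2 * F.card / δ)
  filter_upwards [eventually_ge_atTop N] with n hn D hD hlen
  have hshort : D.countP (fun p => p.length < m) ≤ F.card := by
    rw [List.countP_eq_length_filter, ← List.toFinset_card_of_nodup (hD.filter _)]
    refine Finset.card_le_card fun p hp => ?_
    simpa [hF] using (List.mem_filter.1 (List.mem_toFinset.1 hp)).2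
  have hlong : (m : ℝ) * D.length ≤ m * F.card + n := by
    exact_mod_cast (mul_length_le_add_length_flatten m D).trans
      (add_le_add (Nat.mul_le_mul_left m hshort) hlen)
  have hF_le : 2 * (F.card : ℝ) ≤ δ * n := by
    rw [div_lt_iff₀ hδ] at hN
    have : (N : ℝ) ≤ n := by exact_mod_cast hn
    nlinarith
  have hn_le : 2 * (n : ℝ) ≤ m * (δ * n) := by
    rw [div_lt_iff₀ hδ] at hm
    nlinarith [(Nat.cast_nonneg n : (0 : ℝ) ≤ n)]
  exact le_of_mul_le_mul_left (by nlinarith) hm0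

theorem count_map_eq_length_filter {A B : Type*} [BEq B] [LawfulBEq B] [DecidableEq B] (f : A → B)
    (l : List A) (b : B) : (l.map f).count b = (l.filter fun a => f a = b).length := by
  rw [List.count, List.countP_map, List.countP_eq_length_filter]
  congr 2
  ext a
  rw [Function.comp_apply, beq_eq_decide]

/-- `∏ c(w) ^ c(w)` over the distinct entries `w` of a list, where `c(w)` is the multiplicity. -/
def selfCount {B : Type*} [DecidableEq B] (ws : List B) : ℕ :=
  (ws.map fun w => ws.count w).prod

theorem selfCount_pos {B : Type*} [DecidableEq B] (ws : List B) : 0 < selfCount ws := by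
  refine List.prod_pos fun a ha => ?_
  obtain ⟨w, hw, rfl⟩ := List.mem_map.1 ha
  exact List.count_pos_iff.2 hw

theorem logb_selfCount {B : Type*} [DecidableEq B] (ws : List B) :
    Real.logb 2 (selfCount ws) =
      ∑ w ∈ ws.toFinset, (ws.count w : ℝ) * Real.logb 2 (ws.count w) := by
  rw [selfCount, Finset.prod_list_map_count, Nat.cast_prod, Real.logb_prod]
  · refine Finset.sum_congr rfl fun w _ => ?_
    rw [Nat.cast_pow, Real.logb_pow]
  · intro w hw
    have h := List.count_pos_iff.2 (List.mem_toFinset.1 hw)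
    exact_mod_cast (pow_pos h _).ne'

variable {X Y : Type*} [DecidableEq X] [DecidableEq Y] {n : ℕ}

theorem incremental_jointPhrases (x : Fin n → X) (y : Fin n → Y) :
    Incremental (jointPhrases x y) :=
  (lzParse_spec _ [] [] .nil List.mem_cons_self).1

theorem exists_flatten_jointPhrases (x : Fin n → X) (y : Fin n → Y) :
    ∃ r ∈ [] :: jointPhrases x y,
      (jointPhrases x y).flatten ++ r = List.ofFn fun t => (x t, y t) := by
  simpa [jointPhrases] using
    (lzParse_spec (List.ofFn fun t => (x t, y t)) [] [] .nil List.mem_cons_self).2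

theorem eventually_length_jointPhrases_le (X Y : Type*) [Finite X] [Finite Y] [DecidableEq X]
    [DecidableEq Y] {δ : ℝ} (hδ : 0 < δ) :
    ∀ᶠ n : ℕ in atTop, ∀ (x : Fin n → X) (y : Fin n → Y),
      ((jointPhrases x y).length : ℝ) ≤ δ * n := by
  filter_upwards [eventually_length_le (X × Y) hδ] with n hn x y
  refine hn _ (incremental_jointPhrases x y).nodup ?_
  obtain ⟨r, -, hr⟩ := exists_flatten_jointPhrases x y
  have := congrArg List.length hr
  rw [List.length_append, List.length_ofFn] at this
  omega

/-- The `y`-phrases of the joint parsing, with repetitions, in the order of their occurrence. -/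
def sideList (x : Fin n → X) (y : Fin n → Y) : List (List Y) :=
  (jointPhrases x y).map (List.map Prod.snd)

theorem phraseCount_eq_count (x : Fin n → X) (y : Fin n → Y) (w : List Y) :
    phraseCount x y w = (sideList x y).count w := by
  have h : (jointPhrases x y).toFinset.filter (fun p => p.map Prod.snd = w) =
      ((jointPhrases x y).filter fun p => p.map Prod.snd = w).toFinset := by
    ext p
    simp
  rw [phraseCount, h, List.toFinset_card_of_nodup ((incremental_jointPhrases x y).nodup.filter _),
    sideList, count_map_eq_length_filter]

/-- The Lempel-Ziv weight `2 ^ (n Ĥ_LZ(x | y))`, which is a natural number. -/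
def lzWeight (x : Fin n → X) (y : Fin n → Y) : ℕ := selfCount (sideList x y)

theorem lzWeight_pos (x : Fin n → X) (y : Fin n → Y) : 0 < lzWeight x y := selfCount_pos _

theorem condLZ_eq (x : Fin n → X) (y : Fin n → Y) :
    condLZ x y = Real.logb 2 (lzWeight x y) / n := by
  rw [condLZ, lzWeight, logb_selfCount]
  simp only [phraseCount_eq_count, sidePhrases, sideList]
  congr!

end Parsing

/-! ### A Kraft inequality for conditional Lempel-Ziv compressibility -/

section Kraft

/-- All ways to cut a prefix of a word into nonempty words. -/
def splittings {B : Type*} : List B → List (List (List B))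
  | [] => [[]]
  | b :: l => (splittings l).map ([b] :: ·) ++ (splittings l).map (List.modifyHead (b :: ·))

theorem mem_splittings {B : Type*} (l : List B) :
    ∀ ws : List (List B), (∀ w ∈ ws, w ≠ []) → ws.flatten <+: l → ws ∈ splittings l := by
  induction l with
  | nil =>
    intro ws h0 hp
    have hnil : ∀ w ∈ ws, w = [] := List.flatten_eq_nil_iff.1 (List.prefix_nil.1 hp)
    have : ws = [] := List.eq_nil_iff_forall_not_mem.2 fun w hw => h0 w hw (hnil w hw)
    simp [this, splittings]
  | cons b l ih =>
    intro ws h0 hp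
    rw [splittings, List.mem_append, List.mem_map, List.mem_map]
    match ws with
    | [] => exact Or.inr ⟨[], ih [] (by simp) (by simp), rfl⟩
    | [] :: ws => exact absurd rfl (h0 [] (by simp))
    | [b'] :: ws =>
      simp only [List.flatten_cons, List.cons_append, List.nil_append, List.cons_prefix_cons] at hp
      exact Or.inl ⟨ws, ih ws (fun w hw => h0 w (by simp [hw])) hp.2, by rw [hp.1]⟩
    | (b' :: b'' :: w) :: ws =>
      simp only [List.flatten_cons, List.cons_append, List.cons_prefix_cons] at hp
      refine Or.inr ⟨(b'' :: w) :: ws, ih _ ?_ (by simpa using hp.2), by simp [hp.1]⟩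
      exact List.forall_mem_cons.2 ⟨by simp, fun v hv => h0 v (by simp [hv])⟩

theorem sum_splittings {B : Type*} (r : ℝ) (l : List B) :
    ((splittings l).map fun ws => r ^ ws.length).sum = (1 + r) ^ l.length := by
  induction l with
  | nil => simp [splittings]
  | cons b l ih =>
    simp only [splittings, List.map_append, List.map_map, List.sum_append, Function.comp_def,
      List.length_cons, List.length_modifyHead, pow_succ', List.sum_map_mul_left, ih]
    ring

theorem sum_toFinset_le_sum_map {T : Type*} [DecidableEq T] (l : List T) {f : T → ℝ}
    (hf : ∀ a, 0 ≤ f a) : ∑ a ∈ l.toFinset, f a ≤ (l.map f).sum := by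
  rw [Finset.sum_list_map_count]
  refine Finset.sum_le_sum fun a ha => ?_
  have h : 1 ≤ l.count a := List.count_pos_iff.2 (List.mem_toFinset.1 ha)
  simpa using nsmul_le_nsmul_left (hf a) h

theorem card_splittings_le {B : Type*} [DecidableEq B] {r : ℝ} (h0 : 0 < r) (h1 : r ≤ 1)
    (l : List B) (c : ℕ) :
    (((splittings l).toFinset.filter fun ws => ws.length ≤ c).card : ℝ) * r ^ c ≤
      (1 + r) ^ l.length := by
  rw [← sum_splittings r l, ← nsmul_eq_mul, ← Finset.sum_const]
  calc ∑ _ ∈ (splittings l).toFinset.filter fun ws => ws.length ≤ c, r ^ c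
      ≤ ∑ ws ∈ (splittings l).toFinset.filter fun ws => ws.length ≤ c, r ^ ws.length :=
        Finset.sum_le_sum fun ws hws =>
          pow_le_pow_of_le_one h0.le h1 (Finset.mem_filter.1 hws).2
    _ ≤ ∑ ws ∈ (splittings l).toFinset, r ^ ws.length :=
        Finset.sum_le_sum_of_subset_of_nonneg (Finset.filter_subset _ _) fun _ _ _ => by positivity
    _ ≤ _ := sum_toFinset_le_sum_map _ fun _ => by positivity

section Lifts

variable {A B : Type*} [Fintype A] [DecidableEq B]

/-- The parsings that arise from the parsing `D` by adding one phrase with second components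
`w ++ [b]` that extends an earlier phrase by one letter. -/
def phraseExtensions [DecidableEq A] (D : List (List (A × B))) (w : List B) (b : B) :
    Finset (List (List (A × B))) :=
  ((([] :: D).filter fun p => p.map Prod.snd = w).toFinset ×ˢ Finset.univ).image
    fun pa : List (A × B) × A => D ++ [pa.1 ++ [(pa.2, b)]]

theorem mem_phraseExtensions [DecidableEq A] {D E : List (List (A × B))} {w : List B} {b : B} :
    E ∈ phraseExtensions D w b ↔
      ∃ p ∈ [] :: D, p.map Prod.snd = w ∧ ∃ a, D ++ [p ++ [(a, b)]] = E := by
  simp only [phraseExtensions, Finset.mem_image, Finset.mem_product, List.mem_toFinset,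
    List.mem_filter, decide_eq_true_eq, Finset.mem_univ, and_true, Prod.exists]
  exact ⟨fun ⟨p, a, h, e⟩ => ⟨p, h.1, h.2, a, e⟩, fun ⟨p, h, h', a, e⟩ => ⟨p, a, ⟨h, h'⟩, e⟩⟩

theorem card_phraseExtensions_le [DecidableEq A] (D : List (List (A × B))) (w : List B) (b : B) :
    (phraseExtensions D w b).card ≤
      Fintype.card A * ([] :: D.map (List.map Prod.snd)).count w := by
  refine Finset.card_image_le.trans ?_
  rw [Finset.card_product, mul_comm, Finset.card_univ]
  refine Nat.mul_le_mul_left _ ((List.toFinset_card_le _).trans (le_of_eq ?_))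
  rw [show [] :: D.map (List.map Prod.snd) = ([] :: D).map (List.map Prod.snd) from rfl,
    count_map_eq_length_filter]

theorem exists_finset_incremental {g : List B → ℕ} (ws : List (List B))
    (hg : ∀ w, ([] :: ws).count w ≤ g w) :
    ∃ F : Finset (List (List (A × B))),
      (∀ D ∈ F, D.map (List.map Prod.snd) = ws) ∧
      (∀ D, Incremental D → D.map (List.map Prod.snd) = ws → D ∈ F) ∧
      F.card ≤ (ws.map fun w => Fintype.card A * g w.dropLast).prod := by
  classical
  induction ws using List.reverseRecOn with
  | nil => exact ⟨{[]}, by simp, by simp, by simp⟩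
  | append_singleton ws w ih =>
    have hg' : ∀ v, ([] :: ws).count v ≤ g v := fun v =>
      (List.Sublist.count_le v (by simp)).trans (hg v)
    obtain ⟨F, hside, hmem, hcard⟩ := ih hg'
    rcases List.eq_nil_or_concat' w with rfl | ⟨w, b, rfl⟩
    · refine ⟨∅, by simp, fun D hD h => ?_, by simp⟩
      have hnil : [] ∈ D.map (List.map Prod.snd) := by simp [h]
      obtain ⟨p, hp, hp'⟩ := List.mem_map.1 hnil
      exact absurd (List.map_eq_nil_iff.1 hp') (hD.ne_nil p hp)
    refine ⟨F.biUnion fun D => phraseExtensions D w b, fun E hE => ?_, fun E hE h => ?_, ?_⟩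
    · obtain ⟨D, hD, hE⟩ := Finset.mem_biUnion.1 hE
      obtain ⟨p, -, hp, a, rfl⟩ := mem_phraseExtensions.1 hE
      simp [hside D hD, hp]
    · cases hE with
      | nil => simp at h
      | @snoc D p a hD hp _ =>
        simp only [List.map_append, List.map_cons, List.map_nil] at h
        obtain ⟨hD', hpa⟩ := List.append_inj' h rfl
        obtain ⟨hp', ha⟩ := List.append_inj' (List.singleton_inj.1 hpa) rfl
        refine Finset.mem_biUnion.2 ⟨D, hmem D hD hD',
          mem_phraseExtensions.2 ⟨p, hp, hp', a.1, ?_⟩⟩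
        rw [← List.singleton_inj.1 ha]
    · rw [List.map_append, List.prod_append, List.map_singleton, List.prod_singleton,
        List.dropLast_concat]
      refine (Finset.card_biUnion_le_card_mul F _ _ fun D hD => ?_).trans
        (Nat.mul_le_mul_right _ hcard)
      refine (card_phraseExtensions_le D w b).trans (Nat.mul_le_mul_left _ ?_)
      exact hside D hD ▸ hg' w

end Lifts

theorem sum_count_le_length {T : Type*} [DecidableEq T] (l : List T) (s : Finset T) :
    ∑ a ∈ s, l.count a ≤ l.length := by
  rw [← List.sum_toFinset_count_eq_length l]
  exact Finset.sum_le_sum_of_ne_zero fun a _ ha =>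
    List.mem_toFinset.2 (List.count_pos_iff.1 (Nat.pos_of_ne_zero ha))

theorem sum_count_comp_le {K T : Type*} [DecidableEq T] (s : Finset K) (h : K → T) (vs : List T)
    {N : ℕ} (hfib : ∀ t, (s.filter fun k => h k = t).card ≤ N) :
    ∑ k ∈ s, vs.count (h k) ≤ N * vs.length := by
  rw [Finset.sum_comp (fun t => vs.count t) h]
  calc _ ≤ ∑ t ∈ s.image h, N * vs.count t :=
        Finset.sum_le_sum fun t _ => Nat.mul_le_mul_right _ (hfib t)
    _ ≤ N * vs.length := by
        rw [← Finset.mul_sum]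
        exact Nat.mul_le_mul_left _ (sum_count_le_length _ _)

theorem sum_count_dropLast_le {B : Type*} [Fintype B] [DecidableEq B] (s : Finset (List B))
    (vs : List (List B)) :
    ∑ w ∈ s, vs.count w.dropLast ≤ (Fintype.card B + 1) * vs.length := by
  refine le_trans (le_of_eq (by congr!)) (sum_count_comp_le s List.dropLast vs fun p => ?_)
  rw [← Fintype.card_option, ← Finset.card_univ]
  refine Finset.card_le_card_of_injOn List.getLast? (fun _ _ => Finset.mem_univ _) ?_
  intro w hw w' hw' h
  have hp : w.dropLast = w'.dropLast :=
    (Finset.mem_filter.1 hw).2.trans (Finset.mem_filter.1 hw').2.symm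
  rcases List.eq_nil_or_concat' w with rfl | ⟨_, _, rfl⟩ <;>
  rcases List.eq_nil_or_concat' w' with rfl | ⟨_, _, rfl⟩ <;> simp_all

theorem prod_map_le_exp_mul_selfCount {T : Type*} [DecidableEq T] (l : List T) (g : T → ℕ) :
    (((l.map g).prod : ℕ) : ℝ) ≤ Real.exp (∑ a ∈ l.toFinset, (g a : ℝ)) * selfCount l := by
  rw [selfCount, Finset.prod_list_map_count, Finset.prod_list_map_count, Real.exp_sum]
  push_cast
  rw [← Finset.prod_mul_distrib]
  refine Finset.prod_le_prod (fun a _ => by positivity) fun a ha => ?_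
  have hc : (0 : ℝ) < l.count a := by
    exact_mod_cast List.count_pos_iff.2 (List.mem_toFinset.1 ha)
  have h : (g a : ℝ) ≤ Real.exp (g a / l.count a) * l.count a := by
    rw [← div_le_iff₀ hc]
    linarith [Real.add_one_le_exp ((g a : ℝ) / l.count a)]
  calc (g a : ℝ) ^ l.count a
      ≤ (Real.exp (g a / l.count a) * l.count a) ^ l.count a :=
        pow_le_pow_left₀ (Nat.cast_nonneg _) h _
    _ = Real.exp (g a) * (l.count a : ℝ) ^ l.count a := by
        rw [mul_pow, ← Real.exp_nat_mul, mul_div_cancel₀ _ hc.ne']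

theorem sideList_ne_nil {X Y : Type*} [DecidableEq X] [DecidableEq Y] {n : ℕ}
    (x : Fin n → X) (y : Fin n → Y) : ∀ w ∈ sideList x y, w ≠ [] := by
  intro w hw
  obtain ⟨p, hp, rfl⟩ := List.mem_map.1 hw
  simpa using (incremental_jointPhrases x y).ne_nil p hp

theorem flatten_sideList_prefix {X Y : Type*} [DecidableEq X] [DecidableEq Y] {n : ℕ}
    (x : Fin n → X) (y : Fin n → Y) : (sideList x y).flatten <+: List.ofFn y := by
  obtain ⟨r, -, hr⟩ := exists_flatten_jointPhrases x y
  refine ⟨r.map Prod.snd, ?_⟩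
  simpa [List.map_flatten, sideList, List.map_ofFn, Function.comp_def] using
    congrArg (List.map Prod.snd) hr

variable {X Y : Type*} [Fintype X] [DecidableEq X] [DecidableEq Y] {n : ℕ}

theorem card_sideList_eq_le (y : Fin n → Y) (ws : List (List Y)) :
    (Finset.univ.filter fun x : Fin n → X => sideList x y = ws).card ≤
      (ws.map fun w => Fintype.card X * ([] :: ws).count w.dropLast).prod * (ws.length + 1) := by
  obtain ⟨F, hside, hmem, hcard⟩ := exists_finset_incremental (A := X) ws fun _ => le_rfl
  refine le_trans ?_ (Nat.mul_le_mul_right _ hcard)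
  rw [← Finset.card_image_of_injective _ (List.ofFn_injective (α := X) (n := n))]
  refine (Finset.card_le_card (t := F.biUnion fun D => ([] :: D).toFinset.image
    fun r => (D.flatten ++ r).map Prod.fst) fun l hl => ?_).trans
    (Finset.card_biUnion_le_card_mul _ _ _ fun D hD => ?_)
  · obtain ⟨x, hx, rfl⟩ := Finset.mem_image.1 hl
    obtain ⟨r, hr, hr'⟩ := exists_flatten_jointPhrases x y
    refine Finset.mem_biUnion.2 ⟨jointPhrases x y,
      hmem _ (incremental_jointPhrases x y) (Finset.mem_filter.1 hx).2,
      Finset.mem_image.2 ⟨r, List.mem_toFinset.2 hr, ?_⟩⟩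
    rw [hr', List.map_ofFn]
    rfl
  · refine Finset.card_image_le.trans ((List.toFinset_card_le _).trans (le_of_eq ?_))
    rw [List.length_cons, ← hside D hD, List.length_map]

variable [Fintype Y]

theorem card_sideList_eq_le_exp (y : Fin n → Y) (ws : List (List Y)) :
    ((Finset.univ.filter fun x : Fin n → X => sideList x y = ws).card : ℝ) ≤
      Real.exp ((Fintype.card X + Fintype.card Y + 2) * (ws.length + 1)) * selfCount ws := by
  set a : ℝ := (Fintype.card X : ℝ)
  have hletters : a ^ ws.length ≤ Real.exp (a * ws.length) := by
    rw [mul_comm, Real.exp_nat_mul]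
    exact pow_le_pow_left₀ (Nat.cast_nonneg _) (by linarith [Real.add_one_le_exp a]) _
  have hparents : (((ws.map fun w => ([] :: ws).count w.dropLast).prod : ℕ) : ℝ) ≤
      Real.exp ((Fintype.card Y + 1) * (ws.length + 1)) * selfCount ws := by
    refine (prod_map_le_exp_mul_selfCount ws _).trans
      (mul_le_mul_of_nonneg_right (Real.exp_le_exp.2 ?_) (Nat.cast_nonneg _))
    exact_mod_cast sum_count_dropLast_le ws.toFinset ([] :: ws)
  calc ((Finset.univ.filter fun x : Fin n → X => sideList x y = ws).card : ℝ)
      ≤ a ^ ws.length * ((ws.map fun w => ([] :: ws).count w.dropLast).prod : ℕ) *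
          (ws.length + 1) := by
        have h := Nat.cast_le (α := ℝ).2 (card_sideList_eq_le (X := X) y ws)
        rw [List.prod_map_mul, List.map_const', List.prod_replicate] at h
        simpa only [Nat.cast_mul, Nat.cast_pow, Nat.cast_add_one] using h
    _ ≤ Real.exp (a * ws.length) * (Real.exp ((Fintype.card Y + 1) * (ws.length + 1)) *
          selfCount ws) * Real.exp ws.length := by
        gcongr
        exact Real.add_one_le_exp _
    _ = Real.exp (a * ws.length + (Fintype.card Y + 1) * (ws.length + 1) + ws.length) *
          selfCount ws := by
        rw [Real.exp_add, Real.exp_add]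
        ring
    _ ≤ _ := by
        gcongr
        linarith [(Nat.cast_nonneg _ : 0 ≤ a)]

theorem sum_inv_lzWeight_sideList_eq_le (y : Fin n → Y) (ws : List (List Y)) :
    ∑ x : Fin n → X with sideList x y = ws, 1 / (lzWeight x y : ℝ) ≤
      Real.exp ((Fintype.card X + Fintype.card Y + 2) * (ws.length + 1)) := by
  have hpos : (0 : ℝ) < selfCount ws := by exact_mod_cast selfCount_pos ws
  calc ∑ x : Fin n → X with sideList x y = ws, 1 / (lzWeight x y : ℝ)
      = ∑ x : Fin n → X with sideList x y = ws, 1 / (selfCount ws : ℝ) :=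
        Finset.sum_congr rfl fun x hx => by rw [lzWeight, (Finset.mem_filter.1 hx).2]
    _ ≤ _ := by
        rw [Finset.sum_const, nsmul_eq_mul, mul_one_div, div_le_iff₀ hpos]
        exact card_sideList_eq_le_exp y ws

theorem sum_inv_lzWeight_le (y : Fin n → Y) (c : ℕ)
    (hc : ∀ x : Fin n → X, (jointPhrases x y).length ≤ c) {r : ℝ} (hr0 : 0 < r) (hr1 : r ≤ 1) :
    ∑ x : Fin n → X, 1 / (lzWeight x y : ℝ) ≤
      (1 + r) ^ n / r ^ c * Real.exp ((Fintype.card X + Fintype.card Y + 2) * (c + 1)) := by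
  set T := (splittings (List.ofFn y)).toFinset.filter fun ws => ws.length ≤ c
  have hmaps : ∀ x ∈ (Finset.univ : Finset (Fin n → X)), sideList x y ∈ T := fun x _ =>
    Finset.mem_filter.2 ⟨List.mem_toFinset.2 (mem_splittings _ _ (sideList_ne_nil x y)
      (flatten_sideList_prefix x y)), by simpa [sideList] using hc x⟩
  rw [← Finset.sum_fiberwise_of_maps_to hmaps]
  calc _ ≤ ∑ ws ∈ T, Real.exp ((Fintype.card X + Fintype.card Y + 2) * (c + 1)) := by
        refine Finset.sum_le_sum fun ws hws => (sum_inv_lzWeight_sideList_eq_le y ws).trans ?_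
        have hlen : (ws.length : ℝ) ≤ c := by exact_mod_cast (Finset.mem_filter.1 hws).2
        gcongr
    _ ≤ _ := by
        rw [Finset.sum_const, nsmul_eq_mul]
        gcongr
        rw [le_div_iff₀ (by positivity)]
        simpa using card_splittings_le hr0 hr1 (List.ofFn y) c

theorem one_add_pow_div_pow_mul_exp_le {r : ℝ} (hr : 0 < r) (K : ℝ) (n c : ℕ) :
    (1 + r) ^ n / r ^ c * Real.exp (K * (c + 1)) ≤
      Real.exp (r * n + (-Real.log r + K) * c + K) := by
  have hbase : (1 + r) ^ n ≤ Real.exp (n * r) := by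
    rw [Real.exp_nat_mul]
    exact pow_le_pow_left₀ (by positivity) (by linarith [Real.add_one_le_exp r]) _
  calc (1 + r) ^ n / r ^ c * Real.exp (K * (c + 1))
      ≤ Real.exp (n * r) / Real.exp (c * Real.log r) * Real.exp (K * (c + 1)) := by
        rw [Real.exp_nat_mul (Real.log r), Real.exp_log hr]
        gcongr
    _ = Real.exp (r * n + (-Real.log r + K) * c + K) := by
        rw [← Real.exp_sub, ← Real.exp_add]
        ring_nf

/-- Kraft's inequality up to a subexponential factor: the numbers `n Ĥ_LZ(x | y)` are
essentially the lengths of a prefix code for `x` given `y`. -/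
theorem eventually_sum_inv_lzWeight_le (X Y : Type*) [Fintype X] [Finite Y] [DecidableEq X]
    [DecidableEq Y] {ε : ℝ} (hε : 0 < ε) :
    ∀ᶠ n : ℕ in atTop, ∀ y : Fin n → Y,
      ∑ x : Fin n → X, 1 / (lzWeight x y : ℝ) ≤ Real.exp (ε * n) := by
  have := Fintype.ofFinite Y
  set K : ℝ := Fintype.card X + Fintype.card Y + 2
  set r : ℝ := min 1 (ε / 3)
  have hr0 : 0 < r := by positivity
  have hr1 : r ≤ 1 := min_le_left _ _
  have hlog : 0 ≤ -Real.log r := neg_nonneg.2 (Real.log_nonpos hr0.le hr1)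
  have hB : 0 < -Real.log r + K := by positivity
  obtain ⟨N, hN⟩ := exists_nat_gt (3 * K / ε)
  filter_upwards [eventually_length_jointPhrases_le X Y (δ := ε / (3 * (-Real.log r + K)))
    (by positivity), eventually_ge_atTop N] with n hphrases hNn y
  set c := ⌊ε / (3 * (-Real.log r + K)) * n⌋₊
  have hc : (-Real.log r + K) * c ≤ ε / 3 * n := by
    refine (mul_le_mul_of_nonneg_left (Nat.floor_le (by positivity)) hB.le).trans_eq ?_
    field_simp
  have hK : K ≤ ε / 3 * n := by
    rw [div_lt_iff₀ hε] at hN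
    have : (N : ℝ) ≤ n := by exact_mod_cast hNn
    nlinarith
  have hrn : r * n ≤ ε / 3 * n := mul_le_mul_of_nonneg_right (min_le_right _ _) (Nat.cast_nonneg n)
  calc ∑ x : Fin n → X, 1 / (lzWeight x y : ℝ)
      ≤ (1 + r) ^ n / r ^ c * Real.exp (K * (c + 1)) :=
        sum_inv_lzWeight_le y c (fun x => Nat.le_floor (hphrases x y)) hr0 hr1
    _ ≤ Real.exp (r * n + (-Real.log r + K) * c + K) := one_add_pow_div_pow_mul_exp_le hr0 K n c
    _ ≤ Real.exp (ε * n) := Real.exp_le_exp.2 (by linarith)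

end Kraft

/-! ### Rearranging the phrases of a finite-state path -/

section Rearrangement

section StateTrace

variable {S Γ : Type*}

/-- The letters of a word, each with the state in which an automaton reads it. It is also applied
to the automaton `List.foldl step`, which reads whole phrases. -/
def stateTrace (step : S → Γ → S) : S → List Γ → List (S × Γ)
  | _, [] => []
  | s, a :: l => (s, a) :: stateTrace step (step s a) l

theorem stateTrace_append (step : S → Γ → S) (l l' : List Γ) : ∀ s : S,
    stateTrace step s (l ++ l') =
      stateTrace step s l ++ stateTrace step (l.foldl step s) l' := by
  induction l with
  | nil => exact fun _ => rfl
  | cons a l ih => simp [stateTrace, ih]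

theorem map_snd_stateTrace (step : S → Γ → S) (l : List Γ) : ∀ s : S,
    (stateTrace step s l).map Prod.snd = l := by
  induction l with
  | nil => exact fun _ => rfl
  | cons a l ih => simp [stateTrace, ih]

theorem length_stateTrace (step : S → Γ → S) (s : S) (l : List Γ) :
    (stateTrace step s l).length = l.length := by
  rw [← List.length_map (f := Prod.snd), map_snd_stateTrace]

theorem getElem_stateTrace (step : S → Γ → S) (l : List Γ) : ∀ (s : S) (i : ℕ)
    (h : i < (stateTrace step s l).length) (h' : i < l.length),
    (stateTrace step s l)[i] = ((l.take i).foldl step s, l[i]) := by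
  induction l with
  | nil => exact fun _ _ _ h' => absurd h' (Nat.not_lt_zero _)
  | cons a l ih =>
    intro s i h h'
    cases i with
    | zero => rfl
    | succ i => exact ih _ _ _ (Nat.lt_of_succ_lt_succ h')

theorem driveState_eq_foldl {n : ℕ} (step : S → Γ → S) (s : S) (a : Fin n → Γ) (t : ℕ)
    (ht : t ≤ n) : driveState step s a t = ((List.ofFn a).take t).foldl step s := by
  induction t with
  | zero => rfl
  | succ t ih =>
    have h : t < n := ht
    rw [driveState, dif_pos h, ih h.le, List.take_succ_eq_append_getElem (by simpa using h),
      List.foldl_concat, List.getElem_ofFn]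

theorem stateTrace_ofFn {n : ℕ} (step : S → Γ → S) (s : S) (a : Fin n → Γ) :
    stateTrace step s (List.ofFn a) = List.ofFn fun t : Fin n => (driveState step s a t, a t) := by
  refine List.ext_getElem (by simp [length_stateTrace]) fun i _ h' => ?_
  have hi : i < n := by simpa using h'
  rw [getElem_stateTrace _ _ _ _ _ (by simpa using hi), List.getElem_ofFn, List.getElem_ofFn,
    driveState_eq_foldl _ _ _ _ hi.le]

theorem stateTrace_flatten (step : S → Γ → S) (D : List (List Γ)) : ∀ s : S,
    stateTrace step s D.flatten =
      (stateTrace (List.foldl step) s D).flatMap fun e => stateTrace step e.1 e.2 := by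
  induction D with
  | nil => exact fun _ => rfl
  | cons p D ih => simp [stateTrace, stateTrace_append, ih]

theorem stateTrace_of_map_eq (step : S → Γ → S) (l : List Γ) : ∀ (s : S) (L : List (S × Γ)),
    L.map (fun e => (e.1, step e.1 e.2)) =
      (stateTrace step s l).map (fun e => (e.1, step e.1 e.2)) →
    stateTrace step s (L.map Prod.snd) = L ∧
      (L.map Prod.snd).foldl step s = l.foldl step s := by
  induction l with
  | nil =>
    intro s L h
    obtain rfl : L = [] := List.map_eq_nil_iff.1 h
    exact ⟨rfl, rfl⟩
  | cons a l ih =>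
    intro s L h
    cases L with
    | nil => simp [stateTrace] at h
    | cons e L =>
      obtain ⟨s', a'⟩ := e
      simp only [stateTrace, List.map_cons, List.cons.injEq, Prod.mk.injEq] at h
      obtain ⟨⟨rfl, hstep⟩, hL⟩ := h
      obtain ⟨htrace, hend⟩ := ih _ L hL
      simp only [List.map_cons, stateTrace, List.foldl_cons, hstep, htrace, hend, and_self]

end StateTrace

theorem count_ofFn {A : Type*} [DecidableEq A] {n : ℕ} (f : Fin n → A) (b : A) :
    (List.ofFn f).count b = Fintype.card {i // f i = b} := by
  rw [← Multiset.coe_count, List.ofFn_eq_map, ← Multiset.map_coe, Multiset.count_map,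
    Fintype.card_subtype, Finset.card_def, Finset.filter_val]
  congr 1
  exact Multiset.filter_congr fun _ _ => eq_comm

theorem sameType_of_perm {A : Type*} {n : ℕ} {a a' : Fin n → A}
    (h : (List.ofFn a').Perm (List.ofFn a)) : SameType a a' := by
  classical
  have hcard : ∀ b, Fintype.card {i // a' i = b} = Fintype.card {i // a i = b} := fun b =>
    (count_ofFn a' b).symm.trans ((h.count_eq b).trans (count_ofFn a b))
  let e := fun b => Fintype.equivOfCardEq (hcard b)
  refine ⟨(Equiv.sigmaFiberEquiv a').symm.trans
    ((Equiv.sigmaCongrRight e).trans (Equiv.sigmaFiberEquiv a)), ?_⟩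
  ext i
  exact ((e (a' i) ⟨i, rfl⟩).2).symm

theorem exists_finset_perm_map_eq {A K : Type*} [DecidableEq K] {l : List A}
    (hl : l.Nodup) (key : A → K) :
    ∃ F : Finset (List A), (∀ l' ∈ F, l'.Perm l ∧ l'.map key = l.map key) ∧
      F.card = ∏ k ∈ (l.map key).toFinset, ((l.map key).count k).factorial := by
  classical
  let f : Fin l.length → K := fun i => key (l.get i)
  have hget : List.ofFn l.get = l := List.ofFn_get l
  have hf : List.ofFn f = l.map key := by
    conv_rhs => rw [← hget, List.map_ofFn]
    rfl
  refine ⟨(Finset.univ : Finset {g : Equiv.Perm (Fin l.length) // f ∘ g = f}).image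
    fun g => List.ofFn (l.get ∘ g.1), fun l' hl' => ?_, ?_⟩
  · obtain ⟨⟨g, hg⟩, -, rfl⟩ := Finset.mem_image.1 hl'
    constructor
    · conv_rhs => rw [← hget]
      exact Equiv.Perm.ofFn_comp_perm g l.get
    · rw [List.map_ofFn, ← hf]
      exact congrArg List.ofFn hg
  · have himage : (l.map key).toFinset = Finset.univ.image f := by
      ext k
      simp [← hf]
    rw [Finset.card_image_of_injective, Finset.card_univ, DomMulAct.stabilizer_card', himage]
    · simp only [← hf, count_ofFn]
    · intro g g' h
      have hcomp := List.ofFn_injective h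
      exact Subtype.ext (Equiv.ext fun i =>
        List.nodup_iff_injective_get.1 hl (congrFun hcomp i))

theorem selfCount_map_le {K T : Type*} [DecidableEq K] [DecidableEq T] (ks : List K) (h : K → T)
    {N : ℕ} (hN : 0 < N) (hfib : ∀ t, (ks.toFinset.filter fun k => h k = t).card ≤ N) :
    (selfCount (ks.map h) : ℝ) ≤
      (N * Real.exp 1) ^ ks.length * ∏ k ∈ ks.toFinset, ((ks.count k).factorial : ℝ) := by
  have hN' : (0 : ℝ) < N := by exact_mod_cast hN
  set m : K → ℕ := fun k => (ks.map h).count (h k)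
  have hpow : ∀ k, (m k : ℝ) ^ ks.count k ≤
      (N : ℝ) ^ ks.count k * (Real.exp (m k / N) * (ks.count k).factorial) := fun k => by
    have := Real.pow_div_factorial_le_exp ((m k : ℝ) / N) (by positivity) (ks.count k)
    rw [div_le_iff₀ (by positivity), div_pow, div_le_iff₀ (by positivity)] at this
    linarith
  have hsum : (∑ k ∈ ks.toFinset, (m k : ℝ) / N) ≤ ks.length := by
    rw [← Finset.sum_div, div_le_iff₀' hN']
    exact_mod_cast (sum_count_comp_le ks.toFinset h (ks.map h) hfib).trans_eq
      (by rw [List.length_map])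
  calc (selfCount (ks.map h) : ℝ) = ∏ k ∈ ks.toFinset, (m k : ℝ) ^ ks.count k := by
        rw [selfCount, List.map_map, Finset.prod_list_map_count]
        push_cast
        rfl
    _ ≤ ∏ k ∈ ks.toFinset,
          (N : ℝ) ^ ks.count k * (Real.exp (m k / N) * (ks.count k).factorial) :=
        Finset.prod_le_prod (fun k _ => by positivity) fun k _ => hpow k
    _ = (N : ℝ) ^ ks.length * (Real.exp (∑ k ∈ ks.toFinset, (m k : ℝ) / N) *
          ∏ k ∈ ks.toFinset, ((ks.count k).factorial : ℝ)) := by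
        rw [Finset.prod_mul_distrib, Finset.prod_mul_distrib, Finset.prod_pow_eq_pow_sum,
          List.sum_toFinset_count_eq_length, Real.exp_sum]
    _ ≤ (N : ℝ) ^ ks.length * (Real.exp ks.length *
          ∏ k ∈ ks.toFinset, ((ks.count k).factorial : ℝ)) := by
        gcongr
    _ = _ := by
        rw [mul_pow, ← Real.exp_nat_mul, mul_one, mul_assoc]

theorem exists_eq_ofFn {A B : Type*} {n : ℕ} (l : List (A × B)) (y : Fin n → B)
    (h : l.map Prod.snd = List.ofFn y) : ∃ x : Fin n → A, l = List.ofFn fun t => (x t, y t) := by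
  obtain rfl : l.length = n := by simpa using congrArg List.length h
  refine ⟨fun t => (l.get t).1, List.ext_getElem (by simp) fun i hi _ => ?_⟩
  have hy : (l.map Prod.snd)[i]'(by simpa using hi) = (List.ofFn y)[i]'(by simpa using hi) := by
    simp only [h]
  rw [List.getElem_map, List.getElem_ofFn] at hy
  rw [List.getElem_ofFn, ← hy]
  rfl

section PathClass

variable {S A B : Type*} {n : ℕ}

/-- The transitions of an automaton along `(x, y)`: the states together with the letters read in
them. -/
def jointPath (step : S → A × B → S) (s : S) (x : Fin n → A) (y : Fin n → B) (t : Fin n) :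
    S × A × B :=
  (driveState step s (fun i => (x i, y i)) t, x t, y t)

open Classical in
/-- The conditional path class of `x` given `y`: the sequences that, together with `y`, lead an
automaton through a rearrangement of the transitions along `(x, y)`. -/
noncomputable def pathClass [Fintype A] (step : S → A × B → S) (s : S)
    (x : Fin n → A) (y : Fin n → B) : Finset (Fin n → A) :=
  Finset.univ.filter fun x' => SameType (jointPath step s x y) (jointPath step s x' y)

theorem mem_pathClass [Fintype A] {step : S → A × B → S} {s : S} {x x' : Fin n → A}
    {y : Fin n → B} : x' ∈ pathClass step s x y ↔
      SameType (jointPath step s x y) (jointPath step s x' y) := by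
  simp [pathClass]

theorem self_mem_pathClass [Fintype A] (step : S → A × B → S) (s : S) (x : Fin n → A)
    (y : Fin n → B) : x ∈ pathClass step s x y :=
  mem_pathClass.2 ⟨1, rfl⟩

/-- Phrases with equal keys can be exchanged in a parsing: the key of a phrase read from a given
state consists of that state, the second components, and the state after the phrase. -/
def phraseKey (step : S → A × B → S) (e : S × List (A × B)) : S × List B × S :=
  (e.1, e.2.map Prod.snd, e.2.foldl step e.1)

theorem stateTrace_of_map_phraseKey_eq {step : S → A × B → S} {s : S} {D : List (List (A × B))}
    {L : List (S × List (A × B))}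
    (h : L.map (phraseKey step) = (stateTrace (List.foldl step) s D).map (phraseKey step)) :
    stateTrace (List.foldl step) s (L.map Prod.snd) = L ∧
      (L.map Prod.snd).foldl (List.foldl step) s = D.foldl (List.foldl step) s := by
  refine stateTrace_of_map_eq _ _ _ _ ?_
  simpa [phraseKey, Function.comp_def] using
    congrArg (List.map fun k : S × List B × S => (k.1, k.2.2)) h

theorem map_snd_of_map_phraseKey_eq {step : S → A × B → S} {s : S} {D : List (List (A × B))}
    {L : List (S × List (A × B))}
    (h : L.map (phraseKey step) = (stateTrace (List.foldl step) s D).map (phraseKey step)) :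
    (L.map Prod.snd).map (List.map Prod.snd) = D.map (List.map Prod.snd) := by
  rw [← map_snd_stateTrace (List.foldl step) D s]
  simpa [phraseKey, Function.comp_def] using
    congrArg (List.map fun k : S × List B × S => k.2.1) h

theorem exists_mem_pathClass [Fintype A] {step : S → A × B → S} {s : S} {x : Fin n → A}
    {y : Fin n → B} {D : List (List (A × B))} {r : List (A × B)}
    (hD : D.flatten ++ r = List.ofFn fun t => (x t, y t)) {L : List (S × List (A × B))}
    (hperm : L.Perm (stateTrace (List.foldl step) s D))
    (hkey : L.map (phraseKey step) = (stateTrace (List.foldl step) s D).map (phraseKey step)) :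
    ∃ x' ∈ pathClass step s x y,
      (L.map Prod.snd).flatten ++ r = List.ofFn fun t => (x' t, y t) := by
  obtain ⟨htrace, hend⟩ := stateTrace_of_map_phraseKey_eq hkey
  have hy : ((L.map Prod.snd).flatten ++ r).map Prod.snd = List.ofFn y := by
    rw [List.map_append, List.map_flatten, map_snd_of_map_phraseKey_eq hkey, ← List.map_flatten,
      ← List.map_append, hD, List.map_ofFn]
    rfl
  obtain ⟨x', hx'⟩ := exists_eq_ofFn _ y hy
  refine ⟨x', mem_pathClass.2 (sameType_of_perm ?_), hx'⟩
  have hpath : (stateTrace step s (List.ofFn fun t => (x' t, y t))).Perm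
      (stateTrace step s (List.ofFn fun t => (x t, y t))) := by
    rw [← hx', ← hD, stateTrace_append, stateTrace_append, List.foldl_flatten, List.foldl_flatten,
      hend, stateTrace_flatten, stateTrace_flatten, htrace]
    exact (hperm.flatMap_right _).append_right _
  rwa [stateTrace_ofFn, stateTrace_ofFn] at hpath

theorem eq_of_map_phraseKey_eq {step : S → A × B → S} {s : S} {D : List (List (A × B))}
    {L L' : List (S × List (A × B))}
    (hL : L.map (phraseKey step) = (stateTrace (List.foldl step) s D).map (phraseKey step))
    (hL' : L'.map (phraseKey step) = (stateTrace (List.foldl step) s D).map (phraseKey step))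
    (h : (L.map Prod.snd).flatten = (L'.map Prod.snd).flatten) : L = L' := by
  have hside := (map_snd_of_map_phraseKey_eq hL).trans (map_snd_of_map_phraseKey_eq hL').symm
  have hlen : (L.map Prod.snd).map List.length = (L'.map Prod.snd).map List.length := by
    simpa [Function.comp_def] using congrArg (List.map List.length) hside
  rw [← (stateTrace_of_map_phraseKey_eq hL).1, ← (stateTrace_of_map_phraseKey_eq hL').1,
    List.eq_iff_flatten_eq.2 ⟨h, hlen⟩]

theorem card_le_card_pathClass [Fintype A] {step : S → A × B → S} {s : S} {x : Fin n → A}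
    {y : Fin n → B} {D : List (List (A × B))} {r : List (A × B)}
    (hD : D.flatten ++ r = List.ofFn fun t => (x t, y t)) {F : Finset (List (S × List (A × B)))}
    (hF : ∀ L ∈ F, L.Perm (stateTrace (List.foldl step) s D) ∧
      L.map (phraseKey step) = (stateTrace (List.foldl step) s D).map (phraseKey step)) :
    F.card ≤ (pathClass step s x y).card := by
  have hex : ∀ L : List (S × List (A × B)), ∃ x' : Fin n → A, L ∈ F →
      x' ∈ pathClass step s x y ∧
        (L.map Prod.snd).flatten ++ r = List.ofFn fun t => (x' t, y t) := fun L => by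
    by_cases hL : L ∈ F
    · obtain ⟨x', hx'⟩ := exists_mem_pathClass hD (hF L hL).1 (hF L hL).2
      exact ⟨x', fun _ => hx'⟩
    · exact ⟨x, fun h => absurd h hL⟩
  choose x' hx' using hex
  refine Finset.card_le_card_of_injOn x' (fun L hL => (hx' L hL).1) fun L hL L' hL' h => ?_
  refine eq_of_map_phraseKey_eq (hF L hL).2 (hF L' hL').2 (List.append_cancel_right (bs := r) ?_)
  rw [(hx' L hL).2, (hx' L' hL').2, h]

theorem lzWeight_le_card_pathClass [Fintype A] [DecidableEq A] [DecidableEq B]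
    [Fintype S] (step : S → A × B → S) (s : S) (x : Fin n → A) (y : Fin n → B) :
    (lzWeight x y : ℝ) ≤
      ((Fintype.card (S × S) : ℕ) * Real.exp 1) ^ (jointPhrases x y).length *
        (pathClass step s x y).card := by
  classical
  obtain ⟨r, -, hr⟩ := exists_flatten_jointPhrases x y
  set L := stateTrace (List.foldl step) s (jointPhrases x y) with hL
  have hnodup : L.Nodup := List.Nodup.of_map Prod.snd (by
    rw [hL, map_snd_stateTrace]
    exact (incremental_jointPhrases x y).nodup)
  have hside : sideList x y = (L.map (phraseKey step)).map fun k => k.2.1 := by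
    rw [sideList, ← map_snd_of_map_phraseKey_eq (step := step) (s := s) rfl, List.map_map,
      List.map_map]
    rfl
  have hlen : (L.map (phraseKey step)).length = (jointPhrases x y).length := by
    rw [List.length_map, hL, length_stateTrace]
  have hfib : ∀ w : List B, ((L.map (phraseKey step)).toFinset.filter fun k => k.2.1 = w).card ≤
      Fintype.card (S × S) := fun w => by
    rw [← Finset.card_univ]
    refine Finset.card_le_card_of_injOn (fun k => (k.1, k.2.2)) (fun _ _ => Finset.mem_univ _) ?_
    rintro ⟨r, w₁, r'⟩ hk ⟨q, w₂, q'⟩ hk' h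
    obtain rfl : w₁ = w := (Finset.mem_filter.1 hk).2
    obtain rfl : w₂ = w₁ := (Finset.mem_filter.1 hk').2
    simp_all
  obtain ⟨F, hF, hcard⟩ := exists_finset_perm_map_eq hnodup (phraseKey step)
  rw [lzWeight, hside, ← hlen]
  refine (selfCount_map_le _ _ (Fintype.card_pos_iff.2 ⟨(s, s)⟩) hfib).trans
    (mul_le_mul_of_nonneg_left ?_ (by positivity))
  exact_mod_cast hcard.symm.trans_le (card_le_card_pathClass hr hF)

theorem eventually_lzWeight_le_card_pathClass (S A B : Type*) [Fintype A] [DecidableEq A]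
    [DecidableEq B] [Finite B] [Finite S] {ε : ℝ} (hε : 0 < ε) :
    ∀ᶠ n : ℕ in atTop, ∀ (step : S → A × B → S) (s : S) (x : Fin n → A) (y : Fin n → B),
      (lzWeight x y : ℝ) ≤ Real.exp (ε * n) * (pathClass step s x y).card := by
  cases nonempty_fintype S
  set K : ℝ := (Fintype.card (S × S) : ℕ) * Real.exp 1
  have hK : 0 ≤ K := by positivity
  filter_upwards [eventually_length_jointPhrases_le A B (δ := ε / (K + 1)) (by positivity)]
    with n hn step s x y
  refine (lzWeight_le_card_pathClass step s x y).trans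
    (mul_le_mul_of_nonneg_right ?_ (Nat.cast_nonneg _))
  calc K ^ (jointPhrases x y).length
      ≤ Real.exp (K + 1) ^ (jointPhrases x y).length :=
        pow_le_pow_left₀ hK (by linarith [Real.add_one_le_exp (K + 1)]) _
    _ = Real.exp ((jointPhrases x y).length * (K + 1)) := (Real.exp_nat_mul _ _).symm
    _ ≤ Real.exp (ε * n) := by
        refine Real.exp_le_exp.2 ((mul_le_mul_of_nonneg_right (hn x y) (by positivity)).trans_eq ?_)
        field_simp

/-- The two properties of the Lempel-Ziv weights of sequences of length `n` on which the coding
argument rests, with a common factor `K`. They express that the weight of `x` given `y` is, up to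
`K`, both the reciprocal of a probability and a lower bound for the size of the path class. -/
structure LZTight [Fintype A] [DecidableEq A] [DecidableEq B] (step : S → A × B → S) (s : S)
    (n : ℕ) (K : ℝ) : Prop where
  sum_inv_le : ∀ y : Fin n → B, ∑ x : Fin n → A, 1 / (lzWeight x y : ℝ) ≤ K
  le_card : ∀ (x : Fin n → A) (y : Fin n → B),
    (lzWeight x y : ℝ) ≤ K * (pathClass step s x y).card

theorem LZTight.mono [Fintype A] [DecidableEq A] [DecidableEq B] {step : S → A × B → S} {s : S}
    {n : ℕ} {K K' : ℝ} (h : LZTight step s n K) (hK : K ≤ K') : LZTight step s n K' where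
  sum_inv_le y := (h.sum_inv_le y).trans hK
  le_card x y := (h.le_card x y).trans (by gcongr)

theorem eventually_lzTight [Fintype A] [DecidableEq A] [DecidableEq B] [Finite B] [Finite S]
    (step : S → A × B → S) (s : S) {ε : ℝ} (hε : 0 < ε) :
    ∀ᶠ n : ℕ in atTop, LZTight step s n (Real.exp (ε * n)) := by
  filter_upwards [eventually_sum_inv_lzWeight_le A B hε,
    eventually_lzWeight_le_card_pathClass S A B hε] with n hsum hcard
  exact ⟨hsum, hcard step s⟩

end PathClass

end Rearrangement

/-! ### Random binning and random codebooks -/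

section FiniteProbability

variable {Ω T : Type*} [Fintype Ω]

/-- The mean of `F` when each outcome `ω` carries the weight `μ ω`. -/
def mean (μ F : Ω → ℝ) : ℝ := ∑ ω, μ ω * F ω

theorem mean_mono_of_pos {μ F G : Ω → ℝ} (hμ : ∀ ω, 0 ≤ μ ω) (h : ∀ ω, 0 < μ ω → F ω ≤ G ω) :
    mean μ F ≤ mean μ G := by
  refine Finset.sum_le_sum fun ω _ => ?_
  rcases (hμ ω).eq_or_lt with h0 | h0
  · simp [← h0]
  · exact mul_le_mul_of_nonneg_left (h ω h0) h0.le

theorem mean_congr_of_pos {μ F G : Ω → ℝ} (hμ : ∀ ω, 0 ≤ μ ω) (h : ∀ ω, 0 < μ ω → F ω = G ω) :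
    mean μ F = mean μ G :=
  (mean_mono_of_pos hμ fun ω hω => (h ω hω).le).antisymm
    (mean_mono_of_pos hμ fun ω hω => (h ω hω).ge)

theorem mean_sum (μ : Ω → ℝ) (s : Finset T) (F : T → Ω → ℝ) :
    mean μ (fun ω => ∑ t ∈ s, F t ω) = ∑ t ∈ s, mean μ (F t) := by
  simp only [mean, Finset.mul_sum]
  exact Finset.sum_comm

theorem mean_const_mul (μ : Ω → ℝ) (c : ℝ) (F : Ω → ℝ) :
    mean μ (fun ω => c * F ω) = c * mean μ F := by
  simp only [mean, Finset.mul_sum, mul_left_comm]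

theorem mean_add (μ F G : Ω → ℝ) : mean μ (fun ω => F ω + G ω) = mean μ F + mean μ G := by
  simp only [mean, mul_add, Finset.sum_add_distrib]

theorem mean_sub (μ F G : Ω → ℝ) : mean μ (fun ω => F ω - G ω) = mean μ F - mean μ G := by
  simp only [mean, mul_sub, Finset.sum_sub_distrib]

open Classical in
/-- The total weight of the event `E`. -/
noncomputable def prob (μ : Ω → ℝ) (E : Ω → Prop) : ℝ :=
  mean μ fun ω => if E ω then 1 else 0

theorem mean_ite (μ : Ω → ℝ) (E : Ω → Prop) [DecidablePred E] :
    mean μ (fun ω => if E ω then 1 else 0) = prob μ E := by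
  unfold prob
  congr!

theorem mean_mul_ite_mono_of_pos {μ w : Ω → ℝ} (hμ : ∀ ω, 0 ≤ μ ω) (hw : ∀ ω, 0 ≤ w ω)
    {E E' : Ω → Prop} [DecidablePred E] [DecidablePred E'] (h : ∀ ω, 0 < μ ω → E ω → E' ω) :
    mean μ (fun ω => w ω * if E ω then 1 else 0) ≤
      mean μ fun ω => w ω * if E' ω then 1 else 0 := by
  refine mean_mono_of_pos hμ fun ω hω => mul_le_mul_of_nonneg_left ?_ (hw ω)
  split_ifs with hE hE'
  exacts [le_rfl, absurd (h ω hω hE) hE', zero_le_one, le_rfl]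

theorem mean_pos {μ F : Ω → ℝ} (hμ : ∀ ω, 0 ≤ μ ω) (hF : ∀ ω, 0 ≤ F ω) {ω : Ω} (hω : 0 < μ ω)
    (hFω : 0 < F ω) : 0 < mean μ F :=
  Finset.sum_pos' (fun ω _ => mul_nonneg (hμ ω) (hF ω)) ⟨ω, Finset.mem_univ ω, mul_pos hω hFω⟩

theorem prob_nonneg {μ : Ω → ℝ} (hμ : ∀ ω, 0 ≤ μ ω) (E : Ω → Prop) : 0 ≤ prob μ E :=
  Finset.sum_nonneg fun ω _ => mul_nonneg (hμ ω) (by positivity)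

theorem prob_le_one {μ : Ω → ℝ} (hμ : IsDistribution μ) (E : Ω → Prop) : prob μ E ≤ 1 := by
  rw [← hμ.2]
  exact Finset.sum_le_sum fun ω _ => mul_le_of_le_one_right (hμ.1 ω) <| by
    dsimp only
    split_ifs <;> norm_num

theorem prob_exists_le_sum {μ : Ω → ℝ} (hμ : ∀ ω, 0 ≤ μ ω) (N : Finset T) (E : T → Ω → Prop) :
    prob μ (fun ω => ∃ i ∈ N, E i ω) ≤ ∑ i ∈ N, prob μ (E i) := by
  classical
  simp_rw [← mean_ite, ← mean_sum]
  refine mean_mono_of_pos hμ fun ω _ => ?_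
  have hnonneg : ∀ i ∈ N, (0 : ℝ) ≤ if E i ω then 1 else 0 := fun i _ => by positivity
  split_ifs with h
  · obtain ⟨i, hi, hE⟩ := h
    simpa [hE] using Finset.single_le_sum hnonneg hi
  · exact Finset.sum_nonneg hnonneg

/-- The second-moment method: the indicator of `Z ≠ 0` is at least `2 t Z - t ^ 2 Z ^ 2`, and the
choice `t = 1 / (1 + 2 m)` is nearly optimal. -/
theorem div_le_prob_ne_zero {μ Z : Ω → ℝ} (hμ : ∀ ω, 0 ≤ μ ω) {m : ℝ} (hm : 0 ≤ m)
    (hZ : mean μ Z = m) (hZ2 : mean μ (fun ω => Z ω ^ 2) ≤ m + 2 * m ^ 2) :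
    m / (1 + 2 * m) ≤ prob μ fun ω => Z ω ≠ 0 := by
  classical
  obtain ⟨t, ht⟩ : ∃ t, t = 1 / (1 + 2 * m) := ⟨_, rfl⟩
  calc m / (1 + 2 * m) = 2 * t * m - t ^ 2 * (m + 2 * m ^ 2) := by
        rw [ht]
        field_simp
        ring
    _ ≤ mean μ (fun ω => 2 * t * Z ω - t ^ 2 * Z ω ^ 2) := by
        rw [mean_sub, mean_const_mul, mean_const_mul, hZ]
        gcongr
    _ ≤ prob μ fun ω => Z ω ≠ 0 := by
        refine mean_mono_of_pos hμ fun ω _ => ?_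
        split_ifs with h
        · nlinarith [sq_nonneg (1 - t * Z ω)]
        · simp [not_not.1 h]

theorem mean_sq_sum_ite_le {μ : Ω → ℝ} {N : Finset T} {E : T → Ω → Prop}
    [∀ i, DecidablePred (E i)] {p : ℝ} (hE : ∀ i ∈ N, prob μ (E i) = p)
    (hpair : ∀ i ∈ N, ∀ i' ∈ N, i ≠ i' → prob μ (fun ω => E i ω ∧ E i' ω) ≤ 2 * p ^ 2) :
    mean μ (fun ω => (∑ i ∈ N, if E i ω then 1 else 0) ^ 2) ≤
      N.card * p + 2 * (N.card * p) ^ 2 := by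
  classical
  have hrow : ∀ i ∈ N, ∑ i' ∈ N, prob μ (fun ω => E i ω ∧ E i' ω) ≤ p + N.card * (2 * p ^ 2) := by
    intro i hi
    rw [← Finset.add_sum_erase _ _ hi]
    refine add_le_add (by simpa only [and_self] using (hE i hi).le) ?_
    refine (Finset.sum_le_card_nsmul _ _ (2 * p ^ 2) fun i' hi' =>
      hpair i hi i' (Finset.mem_of_mem_erase hi') (Finset.ne_of_mem_erase hi').symm).trans ?_
    rw [nsmul_eq_mul]
    gcongr
    exact Finset.erase_subset _ _
  have hsq : ∀ ω, (∑ i ∈ N, if E i ω then (1 : ℝ) else 0) ^ 2 =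
      ∑ i ∈ N, ∑ i' ∈ N, if E i ω ∧ E i' ω then 1 else 0 := fun ω => by
    simp only [sq, Finset.sum_mul_sum, ite_and, ite_mul, one_mul, zero_mul]
  simp_rw [hsq, mean_sum, mean_ite]
  refine (Finset.sum_le_card_nsmul _ _ _ hrow).trans (le_of_eq ?_)
  rw [nsmul_eq_mul]
  ring

theorem one_third_mul_min_le_prob_exists {μ : Ω → ℝ} (hμ : ∀ ω, 0 ≤ μ ω) {N : Finset T}
    {E : T → Ω → Prop} {p : ℝ} (hE : ∀ i ∈ N, prob μ (E i) = p)
    (hpair : ∀ i ∈ N, ∀ i' ∈ N, i ≠ i' → prob μ (fun ω => E i ω ∧ E i' ω) ≤ 2 * p ^ 2) :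
    1 / 3 * min 1 (N.card * p) ≤ prob μ fun ω => ∃ i ∈ N, E i ω := by
  classical
  have hcount_nonneg : ∀ ω, (0 : ℝ) ≤ ∑ i ∈ N, if E i ω then 1 else 0 := fun ω =>
    Finset.sum_nonneg fun i _ => by positivity
  obtain ⟨m, hm⟩ : ∃ m, m = N.card * p := ⟨_, rfl⟩
  have hmean : mean μ (fun ω => ∑ i ∈ N, if E i ω then 1 else 0) = m := by
    simp_rw [hm, mean_sum, mean_ite]
    rw [Finset.sum_congr rfl hE, Finset.sum_const, nsmul_eq_mul]
  have hm0 : 0 ≤ m := hmean ▸ Finset.sum_nonneg fun ω _ => mul_nonneg (hμ ω) (hcount_nonneg ω)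
  have hmin : 1 / 3 * min 1 m ≤ m / (1 + 2 * m) := by
    rw [le_div_iff₀ (by positivity)]
    rcases le_total 1 m with h | h
    · rw [min_eq_left h]
      linarith
    · rw [min_eq_right h]
      nlinarith
  have hsecond := div_le_prob_ne_zero hμ hm0 hmean (hm ▸ mean_sq_sum_ite_le hE hpair)
  rw [← hm]
  refine hmin.trans (hsecond.trans_eq (congrArg (prob μ) (funext fun ω => propext ?_)))
  simp [Finset.sum_boole, Finset.filter_eq_empty_iff]

end FiniteProbability

section ProductWeights

variable {ι A : Type*} [Fintype ι] [Fintype A] {p : ι → A → ℝ}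

/-- The law of a family of independent letters, the `i`-th of them distributed according to
`p i`. -/
def prodWeight (p : ι → A → ℝ) (f : ι → A) : ℝ := ∏ i, p i (f i)

omit [Fintype A] in
theorem prodWeight_pos_iff (hp : ∀ i a, 0 ≤ p i a) {f : ι → A} :
    0 < prodWeight p f ↔ ∀ i, 0 < p i (f i) := by
  refine ⟨fun h i => (hp i _).lt_of_ne fun h0 => h.ne' ?_, fun h => Finset.prod_pos fun i _ => h i⟩
  exact Finset.prod_eq_zero (Finset.mem_univ i) h0.symm

theorem mean_prodWeight_prod [DecidableEq ι] (hp : ∀ i, ∑ a, p i a = 1) (s : Finset ι)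
    (φ : ι → A → ℝ) :
    mean (prodWeight p) (fun f => ∏ i ∈ s, φ i (f i)) = ∏ i ∈ s, mean (p i) (φ i) := by
  have hite : ∀ g : ι → ℝ, ∏ i ∈ s, g i = ∏ i, if i ∈ s then g i else 1 := fun g => by
    rw [Finset.prod_ite_mem, Finset.univ_inter]
  simp_rw [mean, prodWeight, hite, ← Finset.prod_mul_distrib]
  rw [← Fintype.prod_sum (fun i a => p i a * if i ∈ s then φ i a else 1)]
  refine Finset.prod_congr rfl fun i _ => ?_
  by_cases hi : i ∈ s <;> simp [hi, hp]

theorem isDistribution_prodWeight [DecidableEq ι] (hp : ∀ i, IsDistribution (p i)) :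
    IsDistribution (prodWeight p) :=
  ⟨fun f => Finset.prod_nonneg fun i _ => (hp i).1 (f i), by
    simpa [mean] using mean_prodWeight_prod (fun i => (hp i).2) ∅ fun _ _ => 1⟩

theorem mean_prodWeight_apply [DecidableEq ι] (hp : ∀ i, ∑ a, p i a = 1) (i : ι) (φ : A → ℝ) :
    mean (prodWeight p) (fun f => φ (f i)) = mean (p i) φ := by
  simpa using mean_prodWeight_prod hp {i} fun _ => φ

theorem mean_prodWeight_mul_apply [DecidableEq ι] (hp : ∀ i, ∑ a, p i a = 1) {i j : ι}
    (hij : i ≠ j) (φ ψ : A → ℝ) :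
    mean (prodWeight p) (fun f => φ (f i) * ψ (f j)) = mean (p i) φ * mean (p j) ψ := by
  simpa [Finset.prod_pair hij, hij.symm] using
    mean_prodWeight_prod hp {i, j} fun k => if k = i then φ else ψ

theorem prob_prodWeight_apply [DecidableEq ι] (hp : ∀ i, ∑ a, p i a = 1) (i : ι) (E : A → Prop) :
    prob (prodWeight p) (fun f => E (f i)) = prob (p i) E := by
  classical
  exact mean_prodWeight_apply hp i fun a => if E a then 1 else 0

theorem prob_prodWeight_apply_and [DecidableEq ι] (hp : ∀ i, ∑ a, p i a = 1) {i j : ι}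
    (hij : i ≠ j) (E E' : A → Prop) :
    prob (prodWeight p) (fun f => E (f i) ∧ E' (f j)) = prob (p i) E * prob (p j) E' := by
  classical
  simp_rw [← mean_ite, ← mean_prodWeight_mul_apply hp hij, ite_and, ite_mul, one_mul, zero_mul]

theorem mean_prodWeight_eq_sum_update [DecidableEq ι] [DecidableEq A] (i : ι)
    (F : (ι → A) → ℝ) :
    mean (prodWeight p) F =
      ∑ a, p i a * mean (prodWeight (Function.update p i (Pi.single a 1))) F := by
  have hsplit : ∀ f, prodWeight p f =
      ∑ a, p i a * prodWeight (Function.update p i (Pi.single a 1)) f := fun f => by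
    have hrest : ∀ a, ∏ k ∈ {i}ᶜ, Function.update p i (Pi.single a 1) k (f k) =
        ∏ k ∈ {i}ᶜ, p k (f k) := fun a =>
      Finset.prod_congr rfl fun k hk => by rw [Function.update_of_ne (by simpa using hk)]
    simp_rw [prodWeight, Fintype.prod_eq_mul_prod_compl i, hrest, Function.update_self, ← mul_assoc,
      ← Finset.sum_mul, Pi.single_apply, mul_ite, mul_one, mul_zero]
    simp
  simp_rw [mean, hsplit, Finset.sum_mul, Finset.mul_sum, mul_assoc]
  exact Finset.sum_comm

end ProductWeights

section RandomCoding

variable {I J A : Type*} [Fintype I] [Fintype J]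

/-- The codeword of the source vector `i` under the binning `c.1` and the codebook `c.2`. -/
abbrev codeword (c : (I → J) × (J → A)) (i : I) : A := c.2 (c.1 i)

/-- The law of a binning and a codebook with independent entries: the bin of `i` is distributed
according to `b i`, the codeword of bin `j` according to `r j`. -/
def codeWeight (b : I → J → ℝ) (r : J → A → ℝ) (c : (I → J) × (J → A)) : ℝ :=
  prodWeight b c.1 * prodWeight r c.2

theorem codeWeight_nonneg {b : I → J → ℝ} {r : J → A → ℝ} (hb : ∀ i j, 0 ≤ b i j)
    (hr : ∀ j a, 0 ≤ r j a) (c : (I → J) × (J → A)) : 0 ≤ codeWeight b r c :=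
  mul_nonneg (Finset.prod_nonneg fun i _ => hb i _) (Finset.prod_nonneg fun j _ => hr j _)

theorem codeWeight_pos_iff {b : I → J → ℝ} {r : J → A → ℝ} (hb : ∀ i j, 0 ≤ b i j)
    (hr : ∀ j a, 0 ≤ r j a) {c : (I → J) × (J → A)} :
    0 < codeWeight b r c ↔ (∀ i, 0 < b i (c.1 i)) ∧ ∀ j, 0 < r j (c.2 j) := by
  rw [← prodWeight_pos_iff hb, ← prodWeight_pos_iff hr]
  refine ⟨fun h => ?_, fun h => mul_pos h.1 h.2⟩
  have hb' : 0 ≤ prodWeight b c.1 := Finset.prod_nonneg fun i _ => hb i _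
  exact ⟨pos_of_mul_pos_left h (Finset.prod_nonneg fun j _ => hr j _), pos_of_mul_pos_right h hb'⟩

variable [Fintype A] [DecidableEq I] [DecidableEq J]

theorem mean_codeWeight (b : I → J → ℝ) (r : J → A → ℝ) (F : (I → J) × (J → A) → ℝ) :
    mean (codeWeight b r) F =
      mean (prodWeight b) fun f => mean (prodWeight r) fun C => F (f, C) := by
  simp only [mean, codeWeight, Fintype.sum_prod_type, Finset.mul_sum, mul_assoc]

theorem isDistribution_codeWeight {b : I → J → ℝ} {r : J → A → ℝ}
    (hb : ∀ i, IsDistribution (b i)) (hr : ∀ j, IsDistribution (r j)) :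
    IsDistribution (codeWeight b r) := by
  refine ⟨codeWeight_nonneg (fun i => (hb i).1) fun j => (hr j).1, ?_⟩
  simp_rw [codeWeight, Fintype.sum_prod_type, ← Finset.sum_mul_sum,
    (isDistribution_prodWeight hb).2, (isDistribution_prodWeight hr).2, one_mul]

theorem mean_codeWeight_eq_sum_update [DecidableEq A] (b : I → J → ℝ) (r : J → A → ℝ) (i : I)
    (F : (I → J) × (J → A) → ℝ) :
    mean (codeWeight b r) F = ∑ j, ∑ x, b i j * r j x *
      mean (codeWeight (Function.update b i (Pi.single j 1))
        (Function.update r j (Pi.single x 1))) F := by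
  rw [mean_codeWeight, mean_prodWeight_eq_sum_update i]
  refine Finset.sum_congr rfl fun j _ => ?_
  simp_rw [mean_prodWeight_eq_sum_update (p := r) j, mean_sum, mean_const_mul, mul_assoc,
    Finset.mul_sum, mean_codeWeight]

theorem prob_codeWeight_codeword {b : I → J → ℝ} {r : J → A → ℝ} (hb : ∀ i, ∑ j, b i j = 1)
    (hr : ∀ j, ∑ a, r j a = 1) (i : I) (E : A → Prop) :
    prob (codeWeight b r) (fun c => E (codeword c i)) = ∑ j, b i j * prob (r j) E := by
  calc prob (codeWeight b r) (fun c => E (codeword c i))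
      = mean (prodWeight b) fun f => prob (prodWeight r) fun C => E (C (f i)) :=
        mean_codeWeight _ _ _
    _ = mean (prodWeight b) fun f => prob (r (f i)) E := by simp_rw [prob_prodWeight_apply hr _ E]
    _ = ∑ j, b i j * prob (r j) E := mean_prodWeight_apply hb i fun j => prob (r j) E

/-- The second term accounts for the two source vectors falling into the same bin. -/
theorem prob_codeWeight_codeword_and_le {b : I → J → ℝ} {r : J → A → ℝ}
    (hb : ∀ i, IsDistribution (b i)) (hr : ∀ j, IsDistribution (r j)) {i i' : I} (hi : i ≠ i')
    (E : A → Prop) :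
    prob (codeWeight b r) (fun c => E (codeword c i) ∧ E (codeword c i')) ≤
      (∑ j, b i j * prob (r j) E) * (∑ j, b i' j * prob (r j) E) +
        ∑ j, b i j * b i' j * prob (r j) E := by
  classical
  have hpair : ∀ j j', prob (prodWeight r) (fun C => E (C j) ∧ E (C j')) ≤
      prob (r j) E * prob (r j') E +
        ∑ k, (if j = k then prob (r k) E else 0) * if j' = k then 1 else 0 := by
    intro j j'
    rcases eq_or_ne j j' with rfl | hj
    · simp only [and_self, prob_prodWeight_apply (fun j => (hr j).2) j E]
      have := prob_nonneg (hr j).1 E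
      simpa using mul_nonneg this this
    · simp [prob_prodWeight_apply_and (fun j => (hr j).2) hj E E, hj]
  have hb0 := fun f => (isDistribution_prodWeight hb).1 f
  have hb1 := fun i => (hb i).2
  calc prob (codeWeight b r) (fun c => E (codeword c i) ∧ E (codeword c i'))
      = mean (prodWeight b) fun f =>
          prob (prodWeight r) fun C => E (C (f i)) ∧ E (C (f i')) := mean_codeWeight _ _ _
    _ ≤ mean (prodWeight b) fun f => prob (r (f i)) E * prob (r (f i')) E +
          ∑ k, (if f i = k then prob (r k) E else 0) * if f i' = k then 1 else 0 :=
        mean_mono_of_pos hb0 fun f _ => hpair _ _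
    _ = _ := by
        have hprod := mean_prodWeight_mul_apply hb1 hi
        rw [mean_add, mean_sum, hprod (fun j => prob (r j) E) fun j => prob (r j) E]
        simp_rw [fun k => hprod (fun j => if j = k then prob (r k) E else 0)
          fun j => if j = k then 1 else 0]
        simp [mean, mul_right_comm]

end RandomCoding

section Comparison

variable {I A : Type*} [Fintype I] [Fintype A] {M : ℕ}

theorem isDistribution_uniform (hM : 0 < M) : IsDistribution fun _ : Fin M => 1 / (M : ℝ) := by
  have : (M : ℝ) ≠ 0 := by positivity
  exact ⟨fun _ => by positivity, by simp [this]⟩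

theorem isDistribution_single [DecidableEq A] (x : A) : IsDistribution (Pi.single x (1 : ℝ)) :=
  ⟨fun a => by rw [Pi.single_apply]; positivity, by simp⟩

theorem prob_single [DecidableEq A] (x : A) (E : A → Prop) [DecidablePred E] :
    prob (Pi.single x 1) E = if E x then 1 else 0 := by
  simp_rw [← mean_ite, mean, Pi.single_apply, ite_mul, one_mul, zero_mul]
  simp

/-- The law of a random code: uniform bins and codewords drawn from `q`, all independent. -/
noncomputable def randomCode (I : Type*) [Fintype I] (M : ℕ) (q : A → ℝ) :
    (I → Fin M) × (Fin M → A) → ℝ :=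
  codeWeight (fun _ _ => 1 / M) fun _ => q

/-- The law of a random code given that the source vector `i` is in bin `j` and that the codeword
of this bin is `x`. -/
noncomputable def pinnedCode [DecidableEq I] [DecidableEq A] (q : A → ℝ) (i : I) (j : Fin M)
    (x : A) : (I → Fin M) × (Fin M → A) → ℝ :=
  codeWeight (Function.update (fun _ _ => 1 / (M : ℝ)) i (Pi.single j 1))
    (Function.update (fun _ => q) j (Pi.single x 1))

variable {q : A → ℝ}

omit [Fintype A] in
theorem randomCode_nonneg (hq : ∀ a, 0 ≤ q a) (c : (I → Fin M) × (Fin M → A)) :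
    0 ≤ randomCode I M q c :=
  codeWeight_nonneg (fun _ _ => by positivity) (fun _ => hq) c

omit [Fintype A] in
theorem pos_of_randomCode_pos (hq : ∀ a, 0 ≤ q a) {c : (I → Fin M) × (Fin M → A)}
    (hc : 0 < randomCode I M q c) (i : I) : 0 < q (codeword c i) :=
  ((codeWeight_pos_iff (fun _ _ => by positivity) fun _ => hq).1 hc).2 _

variable [DecidableEq I] [DecidableEq A]

omit [Fintype I] in
theorem isDistribution_update_uniform (hM : 0 < M) (i : I) (j : Fin M) (i' : I) :
    IsDistribution
      (Function.update (fun (_ : I) (_ : Fin M) => 1 / (M : ℝ)) i (Pi.single j 1) i') := by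
  rcases eq_or_ne i' i with rfl | hi
  · simpa using isDistribution_single j
  · simpa [hi] using isDistribution_uniform hM

theorem isDistribution_update_single (hq : IsDistribution q) (j : Fin M) (x : A) (k : Fin M) :
    IsDistribution (Function.update (fun _ : Fin M => q) j (Pi.single x 1) k) := by
  rcases eq_or_ne k j with rfl | hk
  · simpa using isDistribution_single x
  · simpa [hk] using hq

theorem isDistribution_pinnedCode (hq : IsDistribution q) (hM : 0 < M) (i : I) (j : Fin M)
    (x : A) : IsDistribution (pinnedCode q i j x) :=
  isDistribution_codeWeight (isDistribution_update_uniform hM i j)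
    (isDistribution_update_single hq j x)

theorem codeword_eq_of_pinnedCode_pos (hq : IsDistribution q) (hM : 0 < M) {i : I} {j : Fin M}
    {x : A} {c : (I → Fin M) × (Fin M → A)} (hc : 0 < pinnedCode q i j x c) :
    codeword c i = x := by
  have hpos := (codeWeight_pos_iff (fun i' => (isDistribution_update_uniform hM i j i').1)
    fun k => (isDistribution_update_single hq j x k).1).1 hc
  have hbin : c.1 i = j := by
    by_contra h
    simpa [h] using hpos.1 i
  by_contra h
  have hx := hpos.2 j
  rw [codeword, hbin] at h
  simp [h] at hx

theorem mean_randomCode_eq_sum_pinnedCode (i : I) (F : (I → Fin M) × (Fin M → A) → ℝ) :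
    mean (randomCode I M q) F = ∑ j, ∑ x, 1 / M * q x * mean (pinnedCode q i j x) F :=
  mean_codeWeight_eq_sum_update _ _ i F

open Classical in
theorem sum_prob_update_single (j : Fin M) (x : A) (E : A → Prop) :
    ∑ k, prob (Function.update (fun _ : Fin M => q) j (Pi.single x 1) k) E =
      (if E x then 1 else 0) + (M - 1) * prob q E := by
  have hM : 0 < M := j.pos
  have hrest : ∀ k ∈ Finset.univ.erase j,
      prob (Function.update (fun _ : Fin M => q) j (Pi.single x 1) k) E = prob q E := fun k hk => by
    rw [Function.update_of_ne (Finset.ne_of_mem_erase hk)]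
  rw [← Finset.add_sum_erase _ _ (Finset.mem_univ j), Function.update_self, prob_single,
    Finset.sum_congr rfl hrest]
  simp [Nat.cast_sub hM]

open Classical in
theorem prob_pinnedCode_codeword (hq : IsDistribution q) {i i' : I} (hi : i' ≠ i) (j : Fin M)
    (x : A) (E : A → Prop) :
    prob (pinnedCode q i j x) (fun c => E (codeword c i')) =
      ((if E x then 1 else 0) + (M - 1) * prob q E) / M := by
  have huniform := fun i' => (isDistribution_update_uniform j.pos i j i').2
  have hsingle := fun k => (isDistribution_update_single hq j x k).2
  rw [pinnedCode, prob_codeWeight_codeword huniform hsingle,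
    Function.update_of_ne hi, ← Finset.mul_sum, sum_prob_update_single, one_div_mul_eq_div]

theorem prob_pinnedCode_codeword_and_le (hq : IsDistribution q) {i i' i'' : I} (hi' : i' ≠ i)
    (hi'' : i'' ≠ i) (hne : i' ≠ i'') (j : Fin M) {x : A} {E : A → Prop} (hx : E x) :
    prob (pinnedCode q i j x) (fun c => E (codeword c i') ∧ E (codeword c i'')) ≤
      2 * ((1 + (M - 1) * prob q E) / M) ^ 2 := by
  have hM : (1 : ℝ) ≤ M := by exact_mod_cast j.pos
  have hprob := prob_nonneg hq.1 E
  obtain ⟨p, hp⟩ : ∃ p, p = (1 + (M - 1) * prob q E) / (M : ℝ) := ⟨_, rfl⟩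
  have hMp : 1 / (M : ℝ) ≤ p := by
    rw [hp]
    gcongr
    nlinarith
  have h := prob_codeWeight_codeword_and_le (isDistribution_update_uniform j.pos i j)
    (isDistribution_update_single hq j x) hne E
  simp only [Function.update_of_ne hi', Function.update_of_ne hi'', ← Finset.mul_sum,
    sum_prob_update_single, if_pos hx] at h
  rw [← hp]
  calc prob (pinnedCode q i j x) (fun c => E (codeword c i') ∧ E (codeword c i''))
      ≤ p * p + 1 / M * p := h.trans_eq (by rw [hp]; ring)
    _ ≤ p * p + p * p := by
        have hp0 : 0 ≤ p := le_trans (by positivity) hMp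
        gcongr
    _ = 2 * p ^ 2 := by ring

theorem one_sixth_mul_min_le_prob_pinnedCode_exists (hq : IsDistribution q) {i : I} {N : Finset I}
    (hN : i ∉ N) (j : Fin M) {x : A} {E : A → Prop} (hx : E x) :
    1 / 6 * min 1 (N.card * (1 / M + prob q E)) ≤
      prob (pinnedCode q i j x) fun c => ∃ i' ∈ N, E (codeword c i') := by
  have hM : (1 : ℝ) ≤ M := by exact_mod_cast j.pos
  have hne : ∀ i' ∈ N, i' ≠ i := fun i' h => ne_of_mem_of_not_mem h hN
  obtain ⟨p, hp⟩ : ∃ p, p = (1 + (M - 1) * prob q E) / (M : ℝ) := ⟨_, rfl⟩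
  have hmoment := one_third_mul_min_le_prob_exists (isDistribution_pinnedCode hq j.pos i j x).1
    (N := N) (E := fun i' c => E (codeword c i')) (p := p)
    (fun i' hi' => by simp [prob_pinnedCode_codeword hq (hne i' hi'), hx, hp])
    fun i' hi' i'' hi'' h =>
      hp ▸ prob_pinnedCode_codeword_and_le hq (hne i' hi') (hne i'' hi'') h j hx
  have hle : 1 / M + prob q E ≤ 2 * p := by
    have h1 := prob_le_one hq E
    have h0 := prob_nonneg hq.1 E
    rw [hp, ← mul_div_assoc, le_div_iff₀ (by linarith), add_mul, one_div,
      inv_mul_cancel₀ (by positivity)]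
    nlinarith
  refine le_trans ?_ hmoment
  have hcard : N.card * (1 / M + prob q E) ≤ 2 * (N.card * p) := by
    rw [mul_left_comm]
    gcongr
  have hmin : min 1 (N.card * (1 / M + prob q E)) ≤ 2 * min 1 (N.card * p) := by
    rw [mul_min_of_nonneg _ _ two_pos.le]
    exact min_le_min (by norm_num) hcard
  linarith

omit [DecidableEq A] in
theorem prob_mul_le_le {β : A → ℝ} (hβ : ∀ a, 0 < β a) {t : ℝ} (ht : 0 ≤ t) :
    prob q (fun a => q a * β a ≤ t) ≤ t * ∑ a, 1 / β a := by
  classical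
  rw [prob, mean, Finset.mul_sum]
  refine Finset.sum_le_sum fun a _ => ?_
  rw [mul_one_div, le_div_iff₀ (hβ a)]
  split_ifs with h
  · rwa [mul_one]
  · simpa using ht

theorem prob_pinnedCode_mul_mul_le_le (hq : IsDistribution q) {α : I → ℝ} {β : A → ℝ}
    (hα : ∀ i, 0 < α i) (hβ : ∀ a, 0 < β a) {K : ℝ} (hKβ : ∑ a, 1 / β a ≤ K) {i i' : I}
    (hi' : i' ≠ i) (j : Fin M) {x : A} (hx : 0 < q x) :
    prob (pinnedCode q i j x)
        (fun c => q (codeword c i') * β (codeword c i') * α i' ≤ q x * β x * α i) ≤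
      α i * (1 / M + q x * β x * K) * (1 / α i') := by
  classical
  have hM : (1 : ℝ) ≤ M := by exact_mod_cast j.pos
  have hαi := hα i
  have hαi' := hα i'
  have hxβ : 0 < q x * β x := mul_pos hx (hβ x)
  have hsame : (if q x * β x * α i' ≤ q x * β x * α i then (1 : ℝ) else 0) ≤ α i / α i' := by
    split_ifs with h
    · rw [one_le_div hαi']
      exact le_of_mul_le_mul_left h hxβ
    · positivity
  have hother : prob q (fun a => q a * β a * α i' ≤ q x * β x * α i) ≤
      q x * β x * α i / α i' * K := by
    simp_rw [← le_div_iff₀ hαi']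
    exact (prob_mul_le_le hβ (by positivity)).trans (by gcongr)
  have hother_nonneg := prob_nonneg hq.1 fun a => q a * β a * α i' ≤ q x * β x * α i
  rw [prob_pinnedCode_codeword hq hi' j x fun a => q a * β a * α i' ≤ q x * β x * α i]
  calc _ ≤ (α i / α i' + M * (q x * β x * α i / α i' * K)) / M := by
        gcongr
        linarith
    _ = _ := by field_simp

theorem prob_pinnedCode_exists_ne_le (hq : IsDistribution q) {α : I → ℝ} {β : A → ℝ}
    (hα : ∀ i, 0 < α i) (hβ : ∀ a, 0 < β a) {K : ℝ} (hK : 1 ≤ K) (hKα : ∑ i, 1 / α i ≤ K)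
    (hKβ : ∑ a, 1 / β a ≤ K) (i : I) (j : Fin M) {x : A} (hx : 0 < q x) :
    prob (pinnedCode q i j x) (fun c => ∃ i' ≠ i,
        q (codeword c i') * β (codeword c i') * α i' ≤ q x * β x * α i) ≤
      K ^ 2 * (α i * (1 / M + q x * β x)) := by
  have hαi := hα i
  have hxβ : 0 < q x * β x := mul_pos hx (hβ x)
  have hunion := prob_exists_le_sum (isDistribution_pinnedCode hq j.pos i j x).1
    (Finset.univ.erase i)
    fun i' c => q (codeword c i') * β (codeword c i') * α i' ≤ q x * β x * α i
  simp only [Finset.mem_erase, Finset.mem_univ, and_true] at hunion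
  calc _ ≤ ∑ i' ∈ Finset.univ.erase i, α i * (1 / M + q x * β x * K) * (1 / α i') :=
        hunion.trans (Finset.sum_le_sum fun i' hi' =>
          prob_pinnedCode_mul_mul_le_le hq hα hβ hKβ (Finset.ne_of_mem_erase hi') j hx)
    _ ≤ α i * (1 / M * K + q x * β x * K) * K := by
        rw [← Finset.mul_sum]
        gcongr
        · exact Finset.sum_nonneg fun i' _ => (one_div_pos.2 (hα i')).le
        · exact le_mul_of_one_le_right (by positivity) hK
        · exact (Finset.sum_le_sum_of_subset_of_nonneg (Finset.erase_subset _ _)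
            fun i' _ _ => (one_div_pos.2 (hα i')).le).trans hKα
    _ = _ := by ring

/-- The union bound for the first event matches the second-moment bound for the second one. -/
theorem prob_pinnedCode_exists_ne_le_prob_exists (hq : IsDistribution q) {α : I → ℝ} {β : A → ℝ}
    (hα : ∀ i, 0 < α i) (hβ : ∀ a, 0 < β a) {K : ℝ} (hK : 1 ≤ K) (hKα : ∑ i, 1 / α i ≤ K)
    (hKβ : ∑ a, 1 / β a ≤ K) {i : I} (j : Fin M) {x : A} (hx : 0 < q x) {N : Finset I}
    (hiN : i ∉ N) (hN : α i ≤ K * N.card) {E : A → Prop} (hxE : E x)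
    (hE : q x * β x ≤ K * prob q E) :
    prob (pinnedCode q i j x) (fun c => ∃ i' ≠ i,
        q (codeword c i') * β (codeword c i') * α i' ≤ q x * β x * α i) ≤
      6 * K ^ 4 * prob (pinnedCode q i j x) fun c => ∃ i' ∈ N, E (codeword c i') := by
  have hbound : α i * (1 / M + q x * β x) ≤ K ^ 2 * (N.card * (1 / M + prob q E)) := by
    have hβx := hβ x
    calc α i * (1 / M + q x * β x) ≤ K * N.card * (K * (1 / M) + K * prob q E) := by
          gcongr
          exact le_mul_of_one_le_left (by positivity) hK
      _ = _ := by ring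
  have hK4 : 1 ≤ K ^ 4 := one_le_pow₀ hK
  calc _ ≤ min (K ^ 4) (K ^ 4 * (N.card * (1 / M + prob q E))) := by
        refine le_min ((prob_le_one (isDistribution_pinnedCode hq j.pos i j x) _).trans hK4) ?_
        refine (prob_pinnedCode_exists_ne_le hq hα hβ hK hKα hKβ i j hx).trans ?_
        calc K ^ 2 * (α i * (1 / M + q x * β x))
            ≤ K ^ 2 * (K ^ 2 * (N.card * (1 / M + prob q E))) := by gcongr
          _ = _ := by ring
    _ = 6 * K ^ 4 * (1 / 6 * min 1 (N.card * (1 / M + prob q E))) := by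
        nth_rw 1 [← mul_one (K ^ 4)]
        rw [← mul_min_of_nonneg _ _ (by positivity)]
        ring
    _ ≤ _ := by
        gcongr
        exact one_sixth_mul_min_le_prob_pinnedCode_exists hq hiN j hxE

end Comparison

open Classical in
theorem mean_randomCode_metric_le {I A : Type*} [Fintype I] [DecidableEq I] [Fintype A] {M : ℕ}
    {q : A → ℝ} (hq : IsDistribution q) (hM : 0 < M) {α : I → ℝ} {β : A → ℝ}
    (hα : ∀ i, 0 < α i) (hβ : ∀ a, 0 < β a) {K : ℝ} (hK : 1 ≤ K) (hKα : ∑ i, 1 / α i ≤ K)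
    (hKβ : ∑ a, 1 / β a ≤ K) {i : I} {N : Finset I} (hiN : i ∉ N) (hN : α i ≤ K * N.card)
    {w : A → ℝ} (hw : ∀ a, 0 ≤ w a) (hwβ : ∀ x, q x * β x ≤ K * prob q fun a => w x ≤ w a) :
    mean (randomCode I M q) (fun c => w (codeword c i) * if ∃ i' ≠ i,
        q (codeword c i') * β (codeword c i') * α i' ≤
          q (codeword c i) * β (codeword c i) * α i then 1 else 0) ≤
      6 * K ^ 4 * mean (randomCode I M q) fun c => w (codeword c i) *
        if ∃ i' ∈ N, w (codeword c i) ≤ w (codeword c i') then 1 else 0 := by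
  have hpin : ∀ (j : Fin M) (x : A) (E : A → (I → Fin M) × (Fin M → A) → Prop)
      [∀ y, DecidablePred (E y)], mean (pinnedCode q i j x) (fun c => w (codeword c i) *
        if E (codeword c i) c then 1 else 0) = w x * prob (pinnedCode q i j x) (E x) := by
    intro j x E _
    rw [← mean_ite, ← mean_const_mul]
    exact mean_congr_of_pos (isDistribution_pinnedCode hq hM i j x).1 fun c hc => by
      rw [codeword_eq_of_pinnedCode_pos hq hM hc]
  rw [mean_randomCode_eq_sum_pinnedCode i, mean_randomCode_eq_sum_pinnedCode i, Finset.mul_sum]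
  refine Finset.sum_le_sum fun j _ => ?_
  rw [Finset.mul_sum]
  refine Finset.sum_le_sum fun x _ => ?_
  rw [hpin j x fun y c => ∃ i' ≠ i,
      q (codeword c i') * β (codeword c i') * α i' ≤ q y * β y * α i,
    hpin j x fun y c => ∃ i' ∈ N, w y ≤ w (codeword c i')]
  rcases (hq.1 x).eq_or_lt with hx | hx
  · simp [← hx]
  · have := prob_pinnedCode_exists_ne_le_prob_exists hq hα hβ hK hKα hKβ j hx hiN hN
      (E := fun a => w x ≤ w a) le_rfl (hwβ x)
    exact (mul_le_mul_of_nonneg_left (mul_le_mul_of_nonneg_left this (hw x))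
      (by positivity)).trans_eq (by ring)

/-! ### Finite-state probabilities -/

section Automaton

variable {S A : Type*} {n : ℕ}

theorem driveState_congr (step : S → A → S) (s : S) {a b : Fin n → A} (t : ℕ)
    (h : ∀ i : Fin n, (i : ℕ) < t → a i = b i) :
    driveState step s a t = driveState step s b t := by
  induction t with
  | zero => rfl
  | succ t ih =>
    rw [driveState, driveState, ih fun i hi => h i (Nat.lt_succ_of_lt hi)]
    split_ifs with ht
    · rw [h ⟨t, ht⟩ (Nat.lt_succ_self t)]
    · rfl

theorem exists_eq_driveState (step : S → A → S) (s : S) (c : Fin n → S → A) :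
    ∃ a : Fin n → A, ∀ t : Fin n, a t = c t (driveState step s a t) := by
  let σ : ℕ → S := fun t => Nat.rec s
    (fun t st => if h : t < n then step st (c ⟨t, h⟩ st) else st) t
  have hσ : ∀ t : ℕ, driveState step s (fun t => c t (σ t)) t = σ t := by
    intro t
    induction t with
    | zero => rfl
    | succ t ih => rw [driveState, ih]
  exact ⟨fun t => c t (σ t), fun t => by rw [hσ]⟩

end Automaton

section Distributions

theorem IsDistribution.exists_pos {A : Type*} [Fintype A] {q : A → ℝ} (hq : IsDistribution q) :
    ∃ a, 0 < q a := by
  by_contra! h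
  have := Finset.sum_nonpos fun a (_ : a ∈ Finset.univ) => h a
  rw [hq.2] at this
  linarith

theorem IsDistribution.le_one {A : Type*} [Fintype A] {q : A → ℝ} (hq : IsDistribution q)
    (a : A) : q a ≤ 1 := by
  rw [← hq.2]
  exact Finset.single_le_sum (fun a _ => hq.1 a) (Finset.mem_univ a)

theorem exists_pos_le_of_pos {ι : Type*} [Finite ι] (f : ι → ℝ) :
    ∃ δ : ℝ, 0 < δ ∧ δ ≤ 1 ∧ ∀ i, 0 < f i → δ ≤ f i := by
  let g : Option ι → ℝ := fun o => o.elim 1 fun i => if 0 < f i then f i else 1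
  obtain ⟨m, hm⟩ := Finite.exists_min g
  refine ⟨g m, ?_, hm none, fun i hi => by simpa [g, hi] using hm (some i)⟩
  cases m with
  | none => exact one_pos
  | some i =>
    simp only [g, Option.elim_some]
    split_ifs with h
    exacts [h, one_pos]

theorem card_filter_not_add_lt_le (n L : ℕ) :
    (Finset.univ.filter fun t : Fin n => ¬ (t : ℕ) + L < n).card ≤ L := by
  refine (Finset.card_le_card_of_injOn (t := Finset.range L) (fun t : Fin n => n - 1 - (t : ℕ))
    (fun t ht => ?_) fun t _ t' _ h => Fin.ext ?_).trans (Finset.card_range L).le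
  · have h := (Finset.mem_filter.1 (Finset.mem_coe.1 ht)).2
    simp only [Finset.mem_coe, Finset.mem_range]
    omega
  · dsimp only at h
    omega

theorem pow_mul_prod_le_prod {n L : ℕ} {δ : ℝ} (hδ0 : 0 ≤ δ) (hδ1 : δ ≤ 1) {f g : Fin n → ℝ}
    (hf0 : ∀ t, 0 ≤ f t) (hf1 : ∀ t, f t ≤ 1) (hfg : ∀ t : Fin n, (t : ℕ) + L < n → g t = f t)
    (hg : ∀ t, δ ≤ g t) : δ ^ L * ∏ t, f t ≤ ∏ t, g t := by
  have hpow : δ ^ L ≤ ∏ t : Fin n, if (t : ℕ) + L < n then 1 else δ := by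
    rw [Finset.prod_ite, Finset.prod_const_one, one_mul, Finset.prod_const]
    exact pow_le_pow_of_le_one hδ0 hδ1 (card_filter_not_add_lt_le n L)
  refine (mul_le_mul_of_nonneg_right hpow (Finset.prod_nonneg fun t _ => hf0 t)).trans ?_
  rw [← Finset.prod_mul_distrib]
  refine Finset.prod_le_prod (fun t _ => mul_nonneg (by positivity) (hf0 t)) fun t _ => ?_
  split_ifs with ht
  · rw [one_mul, hfg t ht]
  · exact (mul_le_of_le_one_right hδ0 (hf1 t)).trans (hg t)

end Distributions

section FiniteState

variable {U V S X Y Z : Type*} {n : ℕ}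

/-- The state transition of a source, as an automaton that reads pairs `(u, v)`. -/
abbrev FiniteStateSource.step [Fintype U] [Fintype V] (src : FiniteStateSource U V S) (s : S)
    (a : U × V) : S :=
  src.next s a.1 a.2

/-- The state transition of a channel, as an automaton that reads pairs `(x, y)`. -/
abbrev FiniteStateChannel.step [Fintype Y] (W : FiniteStateChannel X Y Z) (z : Z) (a : X × Y) : Z :=
  W.next z a.1 a.2

theorem FiniteStateSource.seqProb_nonneg [Fintype U] [Fintype V] (src : FiniteStateSource U V S)
    (s : S) (u : Fin n → U) (v : Fin n → V) : 0 ≤ src.seqProb s u v :=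
  Finset.prod_nonneg fun _ _ => (src.isDistribution _).1 _

theorem FiniteStateChannel.seqProb_nonneg [Fintype Y] (W : FiniteStateChannel X Y Z) (z : Z)
    (x : Fin n → X) (y : Fin n → Y) : 0 ≤ W.seqProb z x y :=
  Finset.prod_nonneg fun _ _ => (W.isDistribution _ _).1 _

theorem FiniteStateSource.exists_seqProb_pos [Fintype U] [Fintype V]
    (src : FiniteStateSource U V S) (s : S) (n : ℕ) :
    ∃ (u : Fin n → U) (v : Fin n → V), 0 < src.seqProb s u v := by
  choose c hc using fun s => (src.isDistribution s).exists_pos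
  obtain ⟨a, ha⟩ := exists_eq_driveState (n := n) src.step s fun _ => c
  refine ⟨fun t => (a t).1, fun t => (a t).2, Finset.prod_pos fun t _ => ?_⟩
  change 0 < src.prob (driveState src.step s a t) (a t)
  rw [ha t]
  exact hc _

theorem FiniteStateChannel.exists_seqProb_pos [Fintype Y] (W : FiniteStateChannel X Y Z) (z : Z)
    (x : Fin n → X) : ∃ y : Fin n → Y, 0 < W.seqProb z x y := by
  choose c hc using fun z x => (W.isDistribution z x).exists_pos
  obtain ⟨a, ha⟩ := exists_eq_driveState W.step z fun t z => (x t, c z (x t))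
  obtain rfl : x = fun t => (a t).1 := funext fun t => by rw [ha t]
  refine ⟨fun t => (a t).2, Finset.prod_pos fun t _ => ?_⟩
  change 0 < W.prob (driveState W.step z a t) (a t).1 (a t).2
  rw [ha t]
  exact hc _ _

/-- Ambiguity, quantitatively: another source vector is almost as likely as the given one. -/
theorem FiniteStateSource.Ambiguous.exists_le [Fintype U] [Fintype V] [Finite S]
    {src : FiniteStateSource U V S} {s : S} (h : src.Ambiguous s) :
    ∃ κ : ℝ, 0 < κ ∧ κ ≤ 1 ∧ ∀ᶠ n : ℕ in atTop, ∀ (u : Fin n → U) (v : Fin n → V),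
      0 < src.seqProb s u v → ∃ u' ≠ u, κ * src.seqProb s u v ≤ src.seqProb s u' v := by
  obtain ⟨L, hL⟩ := h
  obtain ⟨δ, hδ0, hδ1, hδ⟩ := exists_pos_le_of_pos fun e : S × U × V => src.prob e.1 e.2
  refine ⟨δ ^ L, pow_pos hδ0 L, pow_le_one₀ hδ0.le hδ1, ?_⟩
  filter_upwards [eventually_ge_atTop L] with n hn u v huv
  obtain ⟨u', hne, hprefix, hpos⟩ := hL n hn u v huv
  refine ⟨u', hne, pow_mul_prod_le_prod hδ0.le hδ1 (fun _ => (src.isDistribution _).1 _)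
    (fun _ => (src.isDistribution _).le_one _) (fun t ht => ?_) fun t => hδ (_, _) ?_⟩
  · have hstate := driveState_congr src.step s (a := fun i => (u' i, v i))
      (b := fun i => (u i, v i)) t fun i hi => by rw [hprefix i (by omega)]
    rw [hstate, hprefix t ht]
  · refine ((src.isDistribution _).1 _).lt_of_ne fun h0 => hpos.ne' ?_
    exact Finset.prod_eq_zero (Finset.mem_univ t) h0.symm

theorem prod_jointPath_of_mem_pathClass [Fintype X] (step : Z → X × Y → Z) (z : Z)
    {x x' : Fin n → X} {y : Fin n → Y} (h : x' ∈ pathClass step z x y) (φ : Z × X × Y → ℝ) :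
    ∏ t, φ (jointPath step z x' y t) = ∏ t, φ (jointPath step z x y t) := by
  obtain ⟨π, hπ⟩ := mem_pathClass.1 h
  rw [hπ]
  exact Equiv.prod_comp π fun t => φ (jointPath step z x y t)

theorem FiniteStateSource.seqProb_of_mem_pathClass [Fintype U] [Fintype V]
    (src : FiniteStateSource U V S) (s : S) {u u' : Fin n → U} {v : Fin n → V}
    (h : u' ∈ pathClass src.step s u v) : src.seqProb s u' v = src.seqProb s u v :=
  prod_jointPath_of_mem_pathClass src.step s h fun e => src.prob e.1 e.2

theorem FiniteStateChannel.seqProb_of_mem_pathClass [Fintype X] [Fintype Y]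
    (W : FiniteStateChannel X Y Z) (z : Z) {x x' : Fin n → X} {y : Fin n → Y}
    (h : x' ∈ pathClass W.step z x y) : W.seqProb z x' y = W.seqProb z x y :=
  prod_jointPath_of_mem_pathClass W.step z h fun e => W.prob e.1 e.2.1 e.2.2

theorem Exchangeable.eq_of_mem_pathClass [Fintype X] {q : (Fin n → X) → ℝ} (hq : Exchangeable q)
    (step : Z → X × Y → Z) (z : Z) {x x' : Fin n → X} {y : Fin n → Y}
    (h : x' ∈ pathClass step z x y) : q x' = q x := by
  obtain ⟨π, hπ⟩ := mem_pathClass.1 h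
  exact hq x x' ⟨π, funext fun t => congrArg (fun e : Z × X × Y => e.2.1) (congrFun hπ t)⟩

theorem InputDrivenComponent.seq_eq_proj [Fintype Y] {T : Type*} {W : FiniteStateChannel X Y Z}
    (c : InputDrivenComponent W T) (z : Z) (x : Fin n → X) (y : Fin n → Y) (t : Fin n) :
    c.seq z x t = c.proj (jointPath W.step z x y t).1 := by
  have hstate : ∀ t : ℕ, driveState c.next (c.proj z) x t =
      c.proj (driveState W.step z (fun i => (x i, y i)) t) := by
    intro t
    induction t with
    | zero => rfl
    | succ t ih =>
      rw [driveState, driveState, ih]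
      split_ifs
      · rw [c.compat]
      · rfl
  exact hstate t

theorem InputDrivenComponent.Invariant.eq_of_mem_pathClass [Fintype X] [Fintype Y] {T : Type*}
    {W : FiniteStateChannel X Y Z} {c : InputDrivenComponent W T} {z : Z} {q : (Fin n → X) → ℝ}
    (hq : c.Invariant z q) {x x' : Fin n → X} {y : Fin n → Y}
    (h : x' ∈ pathClass W.step z x y) : q x' = q x := by
  obtain ⟨π, hπ⟩ := mem_pathClass.1 h
  refine hq x x' ⟨π, funext fun t => ?_⟩
  rw [c.seq_eq_proj z x' y, Function.comp_apply, c.seq_eq_proj z x y]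
  exact congrArg (fun e : Z × X × Y => (e.2.1, c.proj e.1)) (congrFun hπ t)

end FiniteState

/-! ### Comparison of the decoders -/

section Decision

variable {I : Type*} [Fintype I] [DecidableEq I]

theorem sum_mul_ite_ne (w : I → ℝ) (d : I) :
    ∑ i, w i * (if d ≠ i then 1 else 0) = ∑ i, w i - w d := by
  rw [← Finset.sum_erase_eq_sub (Finset.mem_univ d), ← Finset.filter_ne, Finset.sum_filter]
  simp

open Classical in
/-- Every decision rule errs, up to a constant factor, at least as often as the true vector has
a competitor of comparable weight. -/
theorem sum_competitor_le {w : I → ℝ} (hw : ∀ i, 0 ≤ w i) {κ : ℝ} (hκ : 0 < κ) (d : I) :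
    ∑ i, w i * (if ∃ i' ≠ i, κ * w i ≤ w i' then 1 else 0) ≤
      (1 + 1 / κ) * ∑ i, w i * if d ≠ i then 1 else 0 := by
  rw [sum_mul_ite_ne, ← Finset.sum_erase_eq_sub (Finset.mem_univ d), add_mul, one_mul,
    ← Finset.add_sum_erase _ _ (Finset.mem_univ d), add_comm]
  refine add_le_add (Finset.sum_le_sum fun i _ => mul_le_of_le_one_right (hw i) ?_) ?_
  · split_ifs <;> norm_num
  · split_ifs with h
    · obtain ⟨i', hi', hle⟩ := h
      rw [mul_one, one_div, ← div_eq_inv_mul, le_div_iff₀ hκ, mul_comm]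
      exact hle.trans (Finset.single_le_sum (fun i _ => hw i)
        (Finset.mem_erase.2 ⟨hi', Finset.mem_univ i'⟩))
    · rw [mul_zero]
      exact mul_nonneg (by positivity) (Finset.sum_nonneg fun i _ => hw i)

end Decision

section Decoding

theorem lz_metric_le {U V X Y : Type*} [DecidableEq U] [DecidableEq V] [DecidableEq X]
    [DecidableEq Y] {n : ℕ} {q : (Fin n → X) → ℝ} (hn : 0 < n) {u u' : Fin n → U}
    {v : Fin n → V} {x x' : Fin n → X} {y : Fin n → Y} (hx : 0 < q x) (hx' : 0 < q x')
    (h : infoLZ q x y - condLZ u v ≤ infoLZ q x' y - condLZ u' v) :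
    q x' * lzWeight x' y * lzWeight u' v ≤ q x * lzWeight x y * lzWeight u v := by
  have hU : ∀ u : Fin n → U, (0 : ℝ) < lzWeight u v := fun u => Nat.cast_pos.2 (lzWeight_pos u v)
  have hX : ∀ x : Fin n → X, (0 : ℝ) < lzWeight x y := fun x => Nat.cast_pos.2 (lzWeight_pos x y)
  have hmetric : ∀ (u : Fin n → U) (x : Fin n → X), 0 < q x → infoLZ q x y - condLZ u v =
      -(Real.logb 2 (q x * lzWeight x y * lzWeight u v) / n) := by
    intro u x hx
    rw [infoLZ, condLZ_eq, condLZ_eq, Real.logb_mul (mul_pos hx (hX x)).ne' (hU u).ne',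
      Real.logb_mul hx.ne' (hX x).ne']
    ring
  rw [hmetric u x hx, hmetric u' x' hx', neg_le_neg_iff,
    div_le_div_iff_of_pos_right (Nat.cast_pos.2 hn)] at h
  exact (Real.logb_le_logb one_lt_two (mul_pos (mul_pos hx' (hX x')) (hU u'))
    (mul_pos (mul_pos hx (hX x)) (hU u))).1 h

theorem numBins_pos (R : ℝ) (n : ℕ) : 0 < numBins R n :=
  Nat.ceil_pos.2 (Real.rpow_pos_of_pos two_pos _)

variable {U V S X Y Z : Type*} [Fintype U] [Fintype V] [Fintype Y] {n M : ℕ}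

/-- The joint probability of the source output `(u, v)` and the channel output `y` when the code
`c` is used. -/
def jointProb (src : FiniteStateSource U V S) (s : S) (W : FiniteStateChannel X Y Z) (z : Z)
    (c : ((Fin n → U) → Fin M) × (Fin M → Fin n → X)) (v : Fin n → V) (y : Fin n → Y)
    (u : Fin n → U) : ℝ :=
  src.seqProb s u v * W.seqProb z (codeword c u) y

theorem jointProb_nonneg (src : FiniteStateSource U V S) (s : S) (W : FiniteStateChannel X Y Z)
    (z : Z) (c : ((Fin n → U) → Fin M) × (Fin M → Fin n → X)) (v : Fin n → V) (y : Fin n → Y)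
    (u : Fin n → U) : 0 ≤ jointProb src s W z c v y u :=
  mul_nonneg (src.seqProb_nonneg _ _ _) (W.seqProb_nonneg _ _ _)

theorem card_pathClass_le_two_mul_card {src : FiniteStateSource U V S} {s : S}
    {κ : ℝ} (hκ1 : κ ≤ 1) {u u' : Fin n → U} {v : Fin n → V} (hne : u' ≠ u)
    (hle : κ * src.seqProb s u v ≤ src.seqProb s u' v) {N : Finset (Fin n → U)}
    (hN : ∀ u', u' ∈ N ↔ u' ≠ u ∧ κ * src.seqProb s u v ≤ src.seqProb s u' v) :
    (pathClass src.step s u v).card ≤ 2 * N.card := by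
  classical
  have hsub : (pathClass src.step s u v).erase u ⊆ N := fun u'' hu'' => by
    obtain ⟨hne', hmem⟩ := Finset.mem_erase.1 hu''
    rw [hN, src.seqProb_of_mem_pathClass s hmem]
    exact ⟨hne', mul_le_of_le_one_left (src.seqProb_nonneg _ _ _) hκ1⟩
  have hcard := Finset.card_le_card hsub
  rw [Finset.card_erase_of_mem (self_mem_pathClass _ _ _ _)] at hcard
  have hpos : 0 < N.card := Finset.card_pos.2 ⟨u', (hN u').2 ⟨hne, hle⟩⟩
  omega

variable [Fintype X] {src : FiniteStateSource U V S} {s : S} {W : FiniteStateChannel X Y Z} {z : Z}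
  {q : (Fin n → X) → ℝ}

theorem card_pathClass_mul_le_prob (hq : IsDistribution q) {x : Fin n → X} {y : Fin n → Y}
    (hinv : ∀ x' ∈ pathClass W.step z x y, q x' = q x) :
    (pathClass W.step z x y).card * q x ≤
      prob q fun a => W.seqProb z x y ≤ W.seqProb z a y := by
  classical
  rw [← nsmul_eq_mul, ← Finset.sum_const, prob, mean]
  refine (Finset.sum_congr rfl fun a ha => ?_).trans_le (Finset.sum_le_sum_of_subset_of_nonneg
    (Finset.subset_univ _) fun a _ _ => mul_nonneg (hq.1 a) (by positivity))
  rw [if_pos (W.seqProb_of_mem_pathClass z ha).ge, mul_one, hinv a ha]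

theorem LZTight.lzWeight_le_mul_card [DecidableEq U] [DecidableEq V] {K : ℝ}
    (h : LZTight src.step s n K) (hK : 0 ≤ K) {κ : ℝ} (hκ1 : κ ≤ 1) {u u' : Fin n → U}
    {v : Fin n → V} (hne : u' ≠ u) (hle : κ * src.seqProb s u v ≤ src.seqProb s u' v)
    {N : Finset (Fin n → U)}
    (hN : ∀ u', u' ∈ N ↔ u' ≠ u ∧ κ * src.seqProb s u v ≤ src.seqProb s u' v) :
    (lzWeight u v : ℝ) ≤ 2 * K * N.card := by
  have hcard : ((pathClass src.step s u v).card : ℝ) ≤ 2 * N.card := by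
    exact_mod_cast card_pathClass_le_two_mul_card hκ1 hne hle hN
  calc (lzWeight u v : ℝ) ≤ K * (2 * N.card) := (h.le_card u v).trans (by gcongr)
    _ = 2 * K * N.card := by ring

theorem LZTight.mul_lzWeight_le_prob [DecidableEq X] [DecidableEq Y] {K : ℝ}
    (h : LZTight W.step z n K) (hK : 0 ≤ K) (hq : IsDistribution q) {x : Fin n → X}
    {y : Fin n → Y} (hinv : ∀ x' ∈ pathClass W.step z x y, q x' = q x) :
    q x * lzWeight x y ≤ K * prob q fun a => W.seqProb z x y ≤ W.seqProb z a y := by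
  calc q x * lzWeight x y ≤ q x * (K * (pathClass W.step z x y).card) :=
        mul_le_mul_of_nonneg_left (h.le_card x y) (hq.1 x)
    _ = K * ((pathClass W.step z x y).card * q x) := by ring
    _ ≤ K * prob q fun a => W.seqProb z x y ≤ W.seqProb z a y :=
        mul_le_mul_of_nonneg_left (card_pathClass_mul_le_prob hq hinv) hK

variable [DecidableEq U]

theorem errorProb_eq_mean (src : FiniteStateSource U V S) (s : S) (W : FiniteStateChannel X Y Z)
    (z : Z) (q : (Fin n → X) → ℝ) (d : Decoder U V X Y n M) :
    errorProb src s W z q d = mean (randomCode (Fin n → U) M q) fun c =>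
      ∑ v, ∑ y, ∑ u, jointProb src s W z c v y u * if d c.1 c.2 v y ≠ u then 1 else 0 := by
  unfold errorProb mean
  rw [Fintype.sum_prod_type]
  refine Finset.sum_congr rfl fun f _ => Finset.sum_congr rfl fun C _ => ?_
  rw [Finset.sum_comm, Finset.mul_sum]
  refine Finset.sum_congr rfl fun v _ => ?_
  rw [Finset.sum_comm, Finset.mul_sum]
  refine Finset.sum_congr rfl fun y _ => ?_
  rw [Finset.mul_sum]
  exact Finset.sum_congr rfl fun u _ => mul_assoc _ _ _

theorem errorProb_le_of_isMAPDecoder (hq : IsDistribution q) {d : Decoder U V X Y n M}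
    (hd : IsMAPDecoder src s W z d) (d' : Decoder U V X Y n M) :
    errorProb src s W z q d ≤ errorProb src s W z q d' := by
  rw [errorProb_eq_mean, errorProb_eq_mean]
  refine mean_mono_of_pos (randomCode_nonneg hq.1) fun c _ => Finset.sum_le_sum fun v _ =>
    Finset.sum_le_sum fun y _ => ?_
  rw [sum_mul_ite_ne, sum_mul_ite_ne]
  exact sub_le_sub_left (hd c.1 c.2 v y (d' c.1 c.2 v y)) _

theorem errorProb_pos (hq : IsDistribution q) (hM : 0 < M) {u u' : Fin n → U} {v : Fin n → V}
    (hne : u' ≠ u) (hu : 0 < src.seqProb s u v) (hu' : 0 < src.seqProb s u' v)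
    (d : Decoder U V X Y n M) : 0 < errorProb src s W z q d := by
  obtain ⟨x, hx⟩ := hq.exists_pos
  obtain ⟨y, hy⟩ := W.exists_seqProb_pos z x
  let c : ((Fin n → U) → Fin M) × (Fin M → Fin n → X) := (fun _ => ⟨0, hM⟩, fun _ => x)
  have hc : 0 < randomCode (Fin n → U) M q c :=
    (codeWeight_pos_iff (fun _ _ => by positivity) fun _ => hq.1).2
      ⟨fun _ => by positivity, fun _ => hx⟩
  obtain ⟨u₀, hu₀, hd⟩ : ∃ u₀, 0 < src.seqProb s u₀ v ∧ d c.1 c.2 v y ≠ u₀ := by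
    by_cases h : d c.1 c.2 v y = u
    · exact ⟨u', hu', fun h' => hne (h'.symm.trans h)⟩
    · exact ⟨u, hu, h⟩
  have hnonneg : ∀ c v y u,
      0 ≤ jointProb src s W z c v y u * if d c.1 c.2 v y ≠ u then 1 else 0 := fun c v y u =>
    mul_nonneg (jointProb_nonneg _ _ _ _ _ _ _ _) (by positivity)
  rw [errorProb_eq_mean]
  refine mean_pos (randomCode_nonneg hq.1) (fun c => Finset.sum_nonneg fun v _ =>
    Finset.sum_nonneg fun y _ => Finset.sum_nonneg fun u _ => hnonneg c v y u) hc ?_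
  have hterm : 0 < jointProb src s W z c v y u₀ * if d c.1 c.2 v y ≠ u₀ then 1 else 0 := by
    rw [if_pos hd, mul_one]
    exact mul_pos hu₀ hy
  refine Finset.sum_pos' (fun v _ => Finset.sum_nonneg fun y _ => Finset.sum_nonneg fun u _ =>
    hnonneg c v y u) ⟨v, Finset.mem_univ v, ?_⟩
  refine Finset.sum_pos' (fun y _ => Finset.sum_nonneg fun u _ => hnonneg c v y u)
    ⟨y, Finset.mem_univ y, ?_⟩
  exact Finset.sum_pos' (fun u _ => hnonneg c v y u) ⟨u₀, Finset.mem_univ u₀, hterm⟩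

open Classical in
theorem mean_competitor_le_errorProb (hq : IsDistribution q) {κ : ℝ} (hκ : 0 < κ)
    (d : Decoder U V X Y n M) :
    mean (randomCode (Fin n → U) M q) (fun c => ∑ v, ∑ y, ∑ u, jointProb src s W z c v y u *
      if ∃ u' ≠ u, κ * jointProb src s W z c v y u ≤ jointProb src s W z c v y u'
      then 1 else 0) ≤ (1 + 1 / κ) * errorProb src s W z q d := by
  rw [errorProb_eq_mean, ← mean_const_mul]
  refine mean_mono_of_pos (randomCode_nonneg hq.1) fun c _ => ?_
  simp_rw [Finset.mul_sum _ _ (1 + 1 / κ)]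
  refine Finset.sum_le_sum fun v _ => Finset.sum_le_sum fun y _ => ?_
  rw [← Finset.mul_sum]
  exact sum_competitor_le (jointProb_nonneg src s W z c v y) hκ (d c.1 c.2 v y)

variable [DecidableEq V] [DecidableEq X] [DecidableEq Y]

open Classical in
theorem mean_lz_error_le_mean_competitor (hq : IsDistribution q) (hn : 0 < n) (hM : 0 < M)
    (hinv : ∀ (y : Fin n → Y) (x : Fin n → X), ∀ x' ∈ pathClass W.step z x y, q x' = q x)
    {κ : ℝ} (hκ1 : κ ≤ 1) (hκ : ∀ (u : Fin n → U) (v : Fin n → V), 0 < src.seqProb s u v →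
      ∃ u' ≠ u, κ * src.seqProb s u v ≤ src.seqProb s u' v)
    {K : ℝ} (hK : 1 ≤ K) (hU : LZTight src.step s n K) (hX : LZTight W.step z n K)
    {d : Decoder U V X Y n M} (hd : IsLZDecoder q d) (v : Fin n → V) (y : Fin n → Y)
    (u : Fin n → U) :
    mean (randomCode (Fin n → U) M q)
        (fun c => jointProb src s W z c v y u * if d c.1 c.2 v y ≠ u then 1 else 0) ≤
      6 * (2 * K) ^ 4 * mean (randomCode (Fin n → U) M q) fun c => jointProb src s W z c v y u *
        if ∃ u' ≠ u, κ * jointProb src s W z c v y u ≤ jointProb src s W z c v y u'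
        then 1 else 0 := by
  rcases (src.seqProb_nonneg s u v).eq_or_lt with h0 | huv
  · simp [jointProb, ← h0, mean]
  obtain ⟨u', hne, hle⟩ := hκ u v huv
  let N := Finset.univ.filter fun u' => u' ≠ u ∧ κ * src.seqProb s u v ≤ src.seqProb s u' v
  have hN : ∀ u', u' ∈ N ↔ u' ≠ u ∧ κ * src.seqProb s u v ≤ src.seqProb s u' v := by simp [N]
  have hw : ∀ x, 0 ≤ W.seqProb z x y := fun x => W.seqProb_nonneg z x y
  have hK2 : K ≤ 2 * K := by linarith
  have hmetric := mean_randomCode_metric_le hq hM (i := u) (N := N)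
    (α := fun u => (lzWeight u v : ℝ)) (β := fun x => (lzWeight x y : ℝ))
    (fun u => Nat.cast_pos.2 (lzWeight_pos u v)) (fun x => Nat.cast_pos.2 (lzWeight_pos x y))
    (hK.trans hK2) ((hU.mono hK2).sum_inv_le v) ((hX.mono hK2).sum_inv_le y)
    (by simp [N]) (hU.lzWeight_le_mul_card (by linarith) hκ1 hne hle hN) hw fun x =>
      (hX.mono hK2).mul_lzWeight_le_prob (by linarith) hq (hinv y x)
  simp only [jointProb, mul_assoc (src.seqProb s u v), mean_const_mul]
  rw [mul_left_comm]
  refine mul_le_mul_of_nonneg_left ?_ huv.le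
  refine le_trans ?_ (hmetric.trans (mul_le_mul_of_nonneg_left ?_ (by positivity)))
  · refine mean_mul_ite_mono_of_pos (randomCode_nonneg hq.1) (fun c => hw (codeword c u))
      fun c hc hdu => ⟨d c.1 c.2 v y, hdu, lz_metric_le hn ?_ ?_ (hd c.1 c.2 v y u)⟩
    exacts [pos_of_randomCode_pos hq.1 hc u, pos_of_randomCode_pos hq.1 hc _]
  · refine mean_mul_ite_mono_of_pos (randomCode_nonneg hq.1) (fun c => hw (codeword c u)) ?_
    rintro c - ⟨u', hu', hwle⟩
    obtain ⟨hne', hle'⟩ := (hN u').1 hu'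
    refine ⟨u', hne', ?_⟩
    rw [← mul_assoc]
    exact mul_le_mul hle' hwle (W.seqProb_nonneg _ _ _) (src.seqProb_nonneg _ _ _)

theorem errorProb_lz_le (hq : IsDistribution q) (hn : 0 < n) (hM : 0 < M)
    (hinv : ∀ (y : Fin n → Y) (x : Fin n → X), ∀ x' ∈ pathClass W.step z x y, q x' = q x)
    {κ : ℝ} (hκ0 : 0 < κ) (hκ1 : κ ≤ 1)
    (hκ : ∀ (u : Fin n → U) (v : Fin n → V), 0 < src.seqProb s u v →
      ∃ u' ≠ u, κ * src.seqProb s u v ≤ src.seqProb s u' v)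
    {K : ℝ} (hK : 1 ≤ K) (hU : LZTight src.step s n K) (hX : LZTight W.step z n K)
    {d : Decoder U V X Y n M} (hd : IsLZDecoder q d) (d' : Decoder U V X Y n M) :
    errorProb src s W z q d ≤ 6 * (2 * K) ^ 4 * ((1 + 1 / κ) * errorProb src s W z q d') := by
  refine le_trans ?_
    (mul_le_mul_of_nonneg_left (mean_competitor_le_errorProb hq hκ0 d') (by positivity))
  simp_rw [errorProb_eq_mean, mean_sum, Finset.mul_sum]
  exact Finset.sum_le_sum fun v _ => Finset.sum_le_sum fun y _ => Finset.sum_le_sum fun u _ =>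
    mean_lz_error_le_mean_competitor hq hn hM hinv hκ1 hκ hK hU hX hd v y u

end Decoding

section Exponent

theorem tendsto_logb_div_of_le_exp {r : ℕ → ℝ} (h1 : ∀ᶠ n in atTop, 1 ≤ r n)
    (h : ∀ ε > 0, ∀ᶠ n : ℕ in atTop, r n ≤ Real.exp (ε * n)) :
    Tendsto (fun n : ℕ => (1 / (n : ℝ)) * Real.logb 2 (r n)) atTop (𝓝 0) := by
  refine tendsto_order.2 ⟨fun a ha => ?_, fun a ha => ?_⟩
  · filter_upwards [h1] with n hn
    exact ha.trans_le (mul_nonneg (by positivity) (Real.logb_nonneg one_lt_two hn))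
  · have hlog2 : 0 < Real.log 2 := Real.log_pos one_lt_two
    filter_upwards [h1, h (a * Real.log 2 / 2) (by positivity), eventually_gt_atTop 0]
      with n hn hle hpos
    have hlog : Real.log (r n) ≤ a * Real.log 2 / 2 * n :=
      (Real.log_le_iff_le_exp (one_pos.trans_le hn)).2 hle
    have hn0 : (0 : ℝ) < n := Nat.cast_pos.2 hpos
    rw [one_div_mul_eq_div, div_lt_iff₀ hn0, Real.logb, div_lt_iff₀ hlog2]
    have : 0 < a * n * Real.log 2 := by positivity
    linarith

theorem eventually_const_mul_exp_le (C : ℝ) {δ ε : ℝ} (h : δ < ε) :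
    ∀ᶠ n : ℕ in atTop, C * Real.exp (δ * n) ≤ Real.exp (ε * n) := by
  have hexp : Tendsto (fun n : ℕ => Real.exp ((ε - δ) * n)) atTop atTop :=
    Real.tendsto_exp_atTop.comp (tendsto_natCast_atTop_atTop.const_mul_atTop (sub_pos.2 h))
  filter_upwards [hexp.eventually_ge_atTop C] with n hn
  calc C * Real.exp (δ * n) ≤ Real.exp ((ε - δ) * n) * Real.exp (δ * n) := by gcongr
    _ = Real.exp (ε * n) := by rw [← Real.exp_add]; ring_nf

end Exponent

section Main

variable {U V S X Y Z : Type*} [Fintype U] [Fintype V] [Fintype X] [Fintype Y] [DecidableEq U]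
  {src : FiniteStateSource U V S} {s₁ : S} {W : FiniteStateChannel X Y Z} {z₁ : Z} {M : ℕ → ℕ}
  {Q : ∀ n : ℕ, (Fin n → X) → ℝ}

theorem eventually_errorProb_pos [Finite S] (hsrc : src.Ambiguous s₁) (hM : ∀ n, 0 < M n)
    (hQ : ∀ n, IsDistribution (Q n)) (d : ∀ n : ℕ, Decoder U V X Y n (M n)) :
    ∀ᶠ n in atTop, 0 < errorProb src s₁ W z₁ (Q n) (d n) := by
  obtain ⟨κ, hκ0, -, hκ⟩ := hsrc.exists_le
  filter_upwards [hκ] with n hn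
  obtain ⟨u, v, huv⟩ := src.exists_seqProb_pos s₁ n
  obtain ⟨u', hne, hle⟩ := hn u v huv
  exact errorProb_pos (hQ n) (hM n) hne huv ((mul_pos hκ0 huv).trans_le hle) _

theorem eventually_errorProb_lz_le_exp_mul [Finite S] [Finite Z] [DecidableEq V] [DecidableEq X]
    [DecidableEq Y] (hsrc : src.Ambiguous s₁) (hM : ∀ n, 0 < M n)
    (hQ : ∀ n, IsDistribution (Q n))
    (hinv : ∀ n (y : Fin n → Y) (x : Fin n → X), ∀ x' ∈ pathClass W.step z₁ x y, Q n x' = Q n x)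
    {dLZ : ∀ n : ℕ, Decoder U V X Y n (M n)} (hLZ : ∀ n, IsLZDecoder (Q n) (dLZ n))
    (d : ∀ n : ℕ, Decoder U V X Y n (M n)) {ε : ℝ} (hε : 0 < ε) :
    ∀ᶠ n : ℕ in atTop, errorProb src s₁ W z₁ (Q n) (dLZ n) ≤
      Real.exp (ε * n) * errorProb src s₁ W z₁ (Q n) (d n) := by
  obtain ⟨κ, hκ0, hκ1, hκ⟩ := hsrc.exists_le
  have hε5 : 0 < ε / 5 := by positivity
  filter_upwards [hκ, eventually_gt_atTop 0, eventually_lzTight src.step s₁ hε5,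
    eventually_lzTight W.step z₁ hε5,
    eventually_errorProb_pos (W := W) (z₁ := z₁) hsrc hM hQ d,
    eventually_const_mul_exp_le (96 * (1 + 1 / κ)) (by linarith : 4 * (ε / 5) < ε)]
    with n hn hn0 hU hX hpos hexp
  have hexp4 : Real.exp (4 * (ε / 5) * n) = Real.exp (ε / 5 * n) ^ 4 := by
    rw [← Real.exp_nat_mul]
    push_cast
    ring_nf
  calc errorProb src s₁ W z₁ (Q n) (dLZ n)
      ≤ 6 * (2 * Real.exp (ε / 5 * n)) ^ 4 *
          ((1 + 1 / κ) * errorProb src s₁ W z₁ (Q n) (d n)) :=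
        errorProb_lz_le (hQ n) hn0 (hM n) (hinv n) hκ0 hκ1 hn (Real.one_le_exp (by positivity))
          hU hX (hLZ n) (d n)
    _ = 96 * (1 + 1 / κ) * Real.exp (4 * (ε / 5) * n) *
          errorProb src s₁ W z₁ (Q n) (d n) := by
        rw [hexp4]
        ring
    _ ≤ Real.exp (ε * n) * errorProb src s₁ W z₁ (Q n) (d n) := by gcongr

end Main

theorem theorem2_general {U V S X Y Z : Type*}
    [Fintype U] [Fintype V] [Fintype X] [Fintype Y] [Finite S] [Finite Z]
    [DecidableEq U] [DecidableEq V] [DecidableEq X] [DecidableEq Y]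
    (src : FiniteStateSource U V S) (s₁ : S) (hsrc : src.Ambiguous s₁)
    (W : FiniteStateChannel X Y Z) (z₁ : Z) (M : ℕ → ℕ) (hM : ∀ n, 0 < M n)
    (Q : ∀ n : ℕ, (Fin n → X) → ℝ) (hQ : ∀ n, IsDistribution (Q n))
    (hinv : ∀ n (y : Fin n → Y) (x : Fin n → X), ∀ x' ∈ pathClass W.step z₁ x y, Q n x' = Q n x)
    (dMAP dLZ : ∀ n : ℕ, Decoder U V X Y n (M n))
    (hMAP : ∀ n, IsMAPDecoder src s₁ W z₁ (dMAP n))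
    (hLZ : ∀ n, IsLZDecoder (Q n) (dLZ n)) :
    (∀ᶠ n in atTop, 0 < errorProb src s₁ W z₁ (Q n) (dMAP n) ∧
      0 < errorProb src s₁ W z₁ (Q n) (dLZ n)) ∧
    Tendsto (fun n : ℕ => (1 / (n : ℝ)) *
      Real.logb 2 (errorProb src s₁ W z₁ (Q n) (dLZ n) /
        errorProb src s₁ W z₁ (Q n) (dMAP n))) atTop (𝓝 0) := by
  have hpos := eventually_errorProb_pos (W := W) (z₁ := z₁) hsrc hM hQ dMAP
  refine ⟨hpos.and (eventually_errorProb_pos hsrc hM hQ dLZ),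
    tendsto_logb_div_of_le_exp ?_ fun ε hε => ?_⟩
  · filter_upwards [hpos] with n hn
    exact (one_le_div hn).2 (errorProb_le_of_isMAPDecoder (hQ n) (hMAP n) (dLZ n))
  · filter_upwards [hpos, eventually_errorProb_lz_le_exp_mul hsrc hM hQ hinv hLZ dMAP hε]
      with n hn hle
    exact (div_le_iff₀ hn).2 hle

theorem theorem2 {U V S X Y Z : Type*}
    [Fintype U] [Fintype V] [Fintype X] [Fintype Y] [Finite S] [Finite Z]
    [DecidableEq U] [DecidableEq V] [DecidableEq X] [DecidableEq Y]
    (src : FiniteStateSource U V S) (s₁ : S) (hsrc : src.Ambiguous s₁)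
    (W : FiniteStateChannel X Y Z) (z₁ : Z)
    (R : ℝ) (hR : 0 < R)
    (Q : ∀ n : ℕ, (Fin n → X) → ℝ) (hQ : ∀ n, IsDistribution (Q n))
    (hinv : (∀ n, Exchangeable (Q n)) ∨
      ∃ (k : ℕ) (c : InputDrivenComponent W (Fin k)), ∀ n, c.Invariant z₁ (Q n))
    (dMAP dLZ : ∀ n : ℕ, Decoder U V X Y n (numBins R n))
    (hMAP : ∀ n, IsMAPDecoder src s₁ W z₁ (dMAP n))
    (hLZ : ∀ n, IsLZDecoder (Q n) (dLZ n)) :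
    (∀ᶠ n in atTop, 0 < errorProb src s₁ W z₁ (Q n) (dMAP n) ∧
      0 < errorProb src s₁ W z₁ (Q n) (dLZ n)) ∧
    Tendsto (fun n : ℕ => (1 / (n : ℝ)) *
      Real.logb 2 (errorProb src s₁ W z₁ (Q n) (dLZ n) /
        errorProb src s₁ W z₁ (Q n) (dMAP n))) atTop (𝓝 0) := by
  refine theorem2_general src s₁ hsrc W z₁ _ (numBins_pos R) Q hQ (fun n y x x' h => ?_) dMAP dLZ
    hMAP hLZ
  exact hinv.elim (fun hQ' => (hQ' n).eq_of_mem_pathClass _ _ h)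
    fun ⟨_, _, hQ'⟩ => (hQ' n).eq_of_mem_pathClass h
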